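/- **Setting.** Let \(n,m,d\in\mathbb N\) with \(n\ge 1\), \(d\ge 2\), and let \(p\in[0,1]\). The training set \(S=(\mathbf x_i,y_i)_{i=1}^m\) consists of i.i.d. pairs, where \(\mathbf x_i\) is uniform on the unit sphere \(\mathbb S^{d-1}\subset\mathbb R^d\) and \(y_i\in\{\pm1\}\) is independent of \(\mathbf x_i\) with \(\Pr[y_i=-1]=p\), \(\Pr[y_i=1]=1-p\); write \(S\sim\mathcal D^m\). Let \(\sigma(z)=\max\{0,z\}\). Fix output weights \(v_1,\dots,v_n\in\{-1,1\}\) with \(|\{j:v_j=1\}|=|\{j:v_j=-1\}|\) (so \(n\) is even), and for \(\boldsymbol\theta=(\mathbf w_j,b_j)_{j=1}^n\in\mathbb R^{(d+1)n}\) let \[N_{\boldsymbol\theta}(\mathbf x)=\sum_{j=1}^n v_j\,\sigma(\mathbf w_j\cdot\mathbf x+b_j).\] The max-margin problem is to minimize \(\|\boldsymbol\theta\|^2\) over the trained parameters \(\boldsymbol\theta=(\mathbf w_j,b_j)_{j}\) subject to \(y_iN_{\boldsymbol\theta}(\mathbf x_i)\ge 1\) for all \(i\in[m]\). A point \(\boldsymbol\theta\)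 is a KKT point of this problem if there are \(\lambda_1,\dots,\lambda_m\ge 0\) and \(\mathbf g_i\in\partial_{\boldsymbol\theta}N_{\boldsymbol\theta}(\mathbf x_i)\) (Clarke subdifferential with respect to \(\boldsymbol\theta\)) such that \(\boldsymbol\theta=\sum_{i=1}^m\lambda_iy_i\mathbf g_i\), \(y_iN_{\boldsymbol\theta}(\mathbf x_i)\ge1\) and \(\lambda_i\,(y_iN_{\boldsymbol\theta}(\mathbf x_i)-1)=0\) for every \(i\in[m]\). The clean test error is \(L_{\mathrm{cl}}(N_{\boldsymbol\theta})=\Pr_{\mathbf x\sim\mathrm{Unif}(\mathbb S^{d-1})}[N_{\boldsymbol\theta}(\mathbf x)\le0]\). **Theorem.** There are universal constants \(c_1,c_2,c_3>0\) such that the following holds for all such \(n,m,d,p,(v_j)\) and all \(\epsilon,\delta>0\). If \[p\le\frac{c_1}{n^2},\qquad m\ge c_2\,n\log\frac1\delta,\qquad d\ge c_3\,m^4n^4\log\frac m\epsilon\,\log\frac{m^2}\delta,\] then with probability at least \(1-\delta\) over \(S\sim\mathcal D^m\), every KKT point \(\boldsymbol\theta\) of the max-margin problem satisfies \(L_{\mathrm{cl}}(N_{\boldsymbol\theta})\le\epsilon\).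 -/

import Mathlib

open MeasureTheory Filter Topology

noncomputable section

namespace BenignKKT

/-- Euclidean space `ℝ^d`. -/
abbrev Vec (d : ℕ) : Type := EuclideanSpace ℝ (Fin d)

/-- The trained parameters `θ = (w_j, b_j)_{j ≤ n}`, `w_j ∈ ℝ^d`, `b_j ∈ ℝ`, of a network of width
`n`, with the Euclidean norm of `ℝ^{(d+1)n}`. The weight `w_j` is `(θ j).fst` and the bias `b_j` is
`(θ j).snd`. -/
abbrev Params (n d : ℕ) : Type := PiLp 2 (fun _ : Fin n => WithLp 2 (Vec d × ℝ))

/-- The ReLU function `σ(z) = max {0, z}`. -/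
def relu (z : ℝ) : ℝ := max 0 z

/-- The two-layer ReLU network `N_θ(x) = ∑_j v_j σ(w_j · x + b_j)` with output weights `v`. -/
def network {n d : ℕ} (v : Fin n → ℝ) (θ : Params n d) (x : Vec d) : ℝ :=
  ∑ j, v j * relu (inner ℝ (θ j).fst x + (θ j).snd)

/-- The Clarke subdifferential of a (locally Lipschitz) function `f` at `x`: the convex hull of all
limits of gradients of `f` along sequences of differentiability points converging to `x`. -/
def clarkeSubdifferential {E : Type*} [NormedAddCommGroup E] [InnerProductSpace ℝ E]
    [CompleteSpace E] (f : E → ℝ) (x : E) : Set E :=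
  convexHull ℝ {g : E | ∃ u : ℕ → E, Tendsto u atTop (𝓝 x) ∧
    (∀ k, DifferentiableAt ℝ f (u k)) ∧ Tendsto (fun k => gradient f (u k)) atTop (𝓝 g)}

/-- `θ` is a KKT point of the margin maximization problem
`min ‖θ‖²  s.t.  y_i N_θ(x_i) ≥ 1 for all i`,
in which the output weights `v` are fixed and `θ = (w_j, b_j)_j` are the variables, for the data set
`S = (x_i, y_i)_i`. Gradients of the network with respect to `θ` are taken in the sense of Clarke,
since the ReLU is not differentiable at `0`. -/
def IsKKTPoint {n d m : ℕ} (v : Fin n → ℝ) (S : Fin m → Vec d × ℝ) (θ : Params n d) : Prop :=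
  ∃ (lam : Fin m → ℝ) (g : Fin m → Params n d),
    (∀ i, g i ∈ clarkeSubdifferential (fun θ' : Params n d => network v θ' (S i).1) θ) ∧
    θ = ∑ i, (lam i * (S i).2) • g i ∧
    (∀ i, 1 ≤ (S i).2 * network v θ (S i).1) ∧
    (∀ i, 0 ≤ lam i) ∧
    (∀ i, lam i * ((S i).2 * network v θ (S i).1 - 1) = 0)

/-- The uniform distribution on the unit sphere of `ℝ^d`, as a measure on `ℝ^d`: the normalized
surface measure. -/
def unifSphere (d : ℕ) : Measure (Vec d) :=
  (((volume : Measure (Vec d)).toSphere Set.univ)⁻¹ • (volume : Measure (Vec d)).toSphere).map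
    (fun x : Metric.sphere (0 : Vec d) 1 => (x : Vec d))

/-- The label distribution: `+1` with probability `1 - p` and `-1` with probability `p`. -/
def labelDist (p : ℝ) : Measure ℝ :=
  ENNReal.ofReal (1 - p) • Measure.dirac 1 + ENNReal.ofReal p • Measure.dirac (-1)

/-- The law of `m` i.i.d. samples `(x_i, y_i)`, with `x_i` uniform on the unit sphere and `y_i` an
independent noisy label. -/
def sampleDist (m d : ℕ) (p : ℝ) : Measure (Fin m → Vec d × ℝ) :=
  Measure.pi (fun _ => (unifSphere d).prod (labelDist p))

/-- The clean test error: the probability that `N_θ(x) ≤ 0` for `x` uniform on the unit sphere. -/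
def cleanError {n d : ℕ} (v : Fin n → ℝ) (θ : Params n d) : ℝ :=
  (unifSphere d).real {x | network v θ x ≤ 0}

end BenignKKT

end

/-! In high dimension the inputs are nearly orthonormal, and so is a fresh input to all of them; a
KKT network at a fresh input is then governed by its biases alone. Stationarity gives `w_j = ∑ y_i
v_j a_ij x_i` and `b_j = ∑ y_i v_j a_ij`, where `a_ij` is the multiplier `λ_i` times a ReLU
subderivative. Up to an error `η`, the preactivation is `y_i v_j a_ij + b_j` at `x_i` and `b_j` at a
fresh input. It therefore suffices that `D`, the sum of `v_j b_j` over the neurons with `b_j > η`,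
exceeds the accumulated error (`sum_relu_pos`).

The core is `biasOutput_gt`. If `D` were not positive beyond the error, the margin would force `λ_i
≥ 1/(2n)` on every positive example, so a live neuron with `v_j = 1` would have bias of order at
least `m/n`. The rare negative examples have bounded multipliers. On a live neuron with `v_j = -1`,
the many positive examples push the bias down until it is of order at most the average of the
negative multipliers over the positive examples. The positive biases then outweigh the negative
ones, a contradiction.

The error is `η = t ∑ λ_i`, with `t` bounding the inner products. Homogeneity and slackness give `∑
λ_i = ‖θ‖²`, and near orthogonality turns this into `∑ λ_i ≤ 2m` (`sum_lam_le`). Cap estimates and a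
Chernoff bound on the number of flipped labels supply the good samples. -/

namespace BenignKKT

/-! ### Concentration on the sphere -/

open Set Metric in
open scoped Pointwise in
-- The normalized surface measure of `A` is the volume fraction of the open cone over `A` in the
-- unit ball; `C` is any set containing that cone.
theorem unifSphere_le {d : ℕ} (hd : 0 < d) {A C : Set (Vec d)} (hA : MeasurableSet A)
    (h : ∀ x ∈ A, ‖x‖ = 1 → ∀ r : ℝ, 0 < r → r < 1 → r • x ∈ C) :
    unifSphere d A ≤ volume C / volume (ball (0 : Vec d) 1) := by
  have hm : MeasurableSet ((fun x : sphere (0 : Vec d) 1 => (x : Vec d)) ⁻¹' A) :=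
    measurable_subtype_coe hA
  have hd' : (d : ENNReal) ≠ 0 := by exact_mod_cast hd.ne'
  rw [unifSphere, Measure.map_apply measurable_subtype_coe hA, Measure.smul_apply,
    Measure.toSphere_apply' _ hm, Measure.toSphere_apply_univ, smul_eq_mul, finrank_euclideanSpace,
    Fintype.card_fin, mul_comm, ← div_eq_mul_inv,
    ENNReal.mul_div_mul_left _ _ hd' (ENNReal.natCast_ne_top d)]
  gcongr
  rintro _ ⟨r, hr, _, ⟨x, hx, rfl⟩, rfl⟩
  exact h _ hx (by simp) r hr.1 hr.2

theorem isProbabilityMeasure_unifSphere {d : ℕ} (hd : 0 < d) :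
    IsProbabilityMeasure (unifSphere d) := by
  have : Nonempty (Fin d) := ⟨⟨0, hd⟩⟩
  have h : (volume : Measure (Vec d)).toSphere ≠ 0 := Measure.toSphere_ne_zero _
  refine ⟨?_⟩
  rw [unifSphere, Measure.map_apply measurable_subtype_coe .univ, Set.preimage_univ,
    Measure.smul_apply, smul_eq_mul]
  exact ENNReal.inv_mul_cancel (Measure.measure_univ_ne_zero.2 h)
    (measure_ne_top _ _)

theorem ae_norm_eq_one_unifSphere (d : ℕ) : ∀ᵐ x ∂(unifSphere d), ‖x‖ = 1 := by
  rw [unifSphere, ae_map_iff measurable_subtype_coe.aemeasurable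
    (measurableSet_eq_fun measurable_norm measurable_const)]
  exact .of_forall fun x => by simp

/-- The cone over the cap lies in the ball of radius `√(1 - t²)` about `t • u`. The squared distance
of `r • x` from the centre is at most `r² - 2rt² + t²`, which is convex in `r`; the endpoint `r = 0`
is where `t² ≤ 1/2` enters. -/
theorem unifSphere_cap_le {d : ℕ} (hd : 0 < d) {u : Vec d} (hu : ‖u‖ = 1) {t : ℝ} (ht : 0 ≤ t)
    (ht2 : t ^ 2 ≤ 1 / 2) :
    unifSphere d {x | t ≤ inner ℝ u x} ≤ ENNReal.ofReal (Real.exp (-(d * t ^ 2 / 2))) := by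
  have : Nonempty (Fin d) := ⟨⟨0, hd⟩⟩
  have hm : MeasurableSet {x : Vec d | t ≤ inner ℝ u x} :=
    (isClosed_le continuous_const (by fun_prop)).measurableSet
  have hr : (0 : ℝ) ≤ √(1 - t ^ 2) := Real.sqrt_nonneg _
  refine (unifSphere_le hd hm (C := Metric.closedBall (t • u) √(1 - t ^ 2)) ?_).trans ?_
  · intro x hx hx1 r hr0 hr1
    rw [Metric.mem_closedBall, dist_eq_norm]
    apply Real.le_sqrt_of_sq_le
    have : ‖r • x - t • u‖ ^ 2 = r ^ 2 - 2 * (r * t * inner ℝ u x) + t ^ 2 := by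
      rw [norm_sub_sq_real, norm_smul, norm_smul, hx1, hu, inner_smul_left, inner_smul_right,
        real_inner_comm]
      simp [mul_assoc]
    rw [this]
    have hx' : t ≤ inner ℝ u x := hx
    have h1 : r * t * t ≤ r * t * inner ℝ u x := by gcongr
    nlinarith
  · rw [Measure.addHaar_closedBall _ _ hr, finrank_euclideanSpace, Fintype.card_fin,
      ENNReal.mul_div_cancel_right (Metric.measure_ball_pos _ _ one_pos).ne' measure_ball_lt_top.ne]
    apply ENNReal.ofReal_le_ofReal
    have h1 : √(1 - t ^ 2) ≤ Real.exp (-(t ^ 2 / 2)) := by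
      apply Real.sqrt_le_iff.2 ⟨(Real.exp_pos _).le, ?_⟩
      rw [← Real.exp_nat_mul]
      have := Real.add_one_le_exp (-t ^ 2)
      calc 1 - t ^ 2 ≤ Real.exp (-t ^ 2) := by linarith
        _ = _ := by congr 1; push_cast; ring
    calc √(1 - t ^ 2) ^ d ≤ Real.exp (-(t ^ 2 / 2)) ^ d := by gcongr
      _ = _ := by rw [← Real.exp_nat_mul]; congr 1; ring

theorem unifSphere_abs_inner_le {d : ℕ} (hd : 0 < d) {u : Vec d} (hu : ‖u‖ = 1) {t : ℝ}
    (ht : 0 ≤ t) (ht2 : t ^ 2 ≤ 1 / 2) :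
    unifSphere d {x | t < |inner ℝ u x|} ≤ ENNReal.ofReal (2 * Real.exp (-(d * t ^ 2 / 2))) := by
  have hsub : {x : Vec d | t < |inner ℝ u x|} ⊆
      {x | t ≤ inner ℝ u x} ∪ {x | t ≤ inner ℝ (-u) x} := by
    intro x (hx : t < |inner ℝ u x|)
    rcases lt_abs.1 hx with h | h
    · exact Or.inl h.le
    · exact Or.inr (by simpa using h.le)
  refine (measure_mono hsub).trans ((measure_union_le _ _).trans ?_)
  rw [two_mul, ENNReal.ofReal_add (by positivity) (by positivity)]
  exact add_le_add (unifSphere_cap_le hd hu ht ht2)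
    (unifSphere_cap_le hd (by rwa [norm_neg]) ht ht2)

theorem unifSphere_singleton {d : ℕ} (hd : 2 ≤ d) (u : Vec d) : unifSphere d {u} = 0 := by
  have hne : Submodule.span ℝ {u} ≠ ⊤ := by
    intro h
    have h1 := finrank_span_le_card (R := ℝ) ({u} : Set (Vec d))
    rw [h, finrank_top, finrank_euclideanSpace, Fintype.card_fin] at h1
    simp at h1
    omega
  have := unifSphere_le (by omega : 0 < d) (measurableSet_singleton u)
    (C := (Submodule.span ℝ {u} : Set (Vec d))) (by
      rintro x rfl - r - -
      exact Submodule.smul_mem _ _ (Submodule.mem_span_singleton_self x))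
  rw [Measure.addHaar_submodule _ _ hne, ENNReal.zero_div] at this
  exact le_antisymm this bot_le

end BenignKKT

/-! ### Random samples: label noise and near orthogonality -/

namespace BenignKKT

theorem isProbabilityMeasure_labelDist {p : ℝ} (hp0 : 0 ≤ p) (hp1 : p ≤ 1) :
    IsProbabilityMeasure (labelDist p) := by
  refine ⟨?_⟩
  simp [labelDist]
  rw [← ENNReal.ofReal_add (by linarith) hp0]
  simp

theorem labelDist_neg_one (p : ℝ) : labelDist p {-1} = ENNReal.ofReal p := by
  have h : ¬ (1 : ℝ) = -1 := by norm_num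
  simp [labelDist, h]

theorem ae_labelDist (p : ℝ) : ∀ᵐ y ∂(labelDist p), y = 1 ∨ y = -1 := by
  have hm : MeasurableSet {y : ℝ | y = 1 ∨ y = -1} :=
    (measurableSet_singleton 1).union (measurableSet_singleton (-1))
  rw [labelDist, ae_add_measure_iff]
  constructor <;> refine Measure.ae_smul_measure ?_ _ <;> rw [ae_dirac_iff hm] <;> simp

/-- The number of negative labels. -/
noncomputable def negCount {m d : ℕ} (S : Fin m → Vec d × ℝ) : ℝ :=
  ∑ i, if (S i).2 = -1 then 1 else 0

theorem measurable_negCount (m d : ℕ) :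
    Measurable (negCount : (Fin m → Vec d × ℝ) → ℝ) := by
  unfold negCount
  refine Finset.measurable_sum _ fun i _ => Measurable.ite ?_ measurable_const measurable_const
  have h : Measurable fun S : Fin m → Vec d × ℝ => (S i).2 := by fun_prop
  exact h (measurableSet_singleton (-1))

theorem exp_three_mul_negCount {m d : ℕ} (S : Fin m → Vec d × ℝ) :
    Real.exp (3 * negCount S) = ∏ i, if (S i).2 = -1 then Real.exp 3 else 1 := by
  rw [negCount, Finset.mul_sum, Real.exp_sum]
  refine Finset.prod_congr rfl fun i _ => ?_
  split_ifs <;> simp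

/-- The samples of unit vectors with pairwise inner products at most `t` and at most `K` negative
labels. -/
def goodSamples (m d : ℕ) (t K : ℝ) : Set (Fin m → Vec d × ℝ) :=
  {S | (∀ i, ‖(S i).1‖ = 1 ∧ ((S i).2 = 1 ∨ (S i).2 = -1)) ∧ negCount S ≤ K ∧
    ∀ i l, i ≠ l → |inner ℝ (S i).1 (S l).1| ≤ t}

theorem measurableSet_goodSamples (m d : ℕ) (t K : ℝ) : MeasurableSet (goodSamples m d t K) := by
  have h1 : ∀ i : Fin m, MeasurableSet
      {S : Fin m → Vec d × ℝ | ‖(S i).1‖ = 1 ∧ ((S i).2 = 1 ∨ (S i).2 = -1)} := fun i => by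
    have hn : Measurable fun S : Fin m → Vec d × ℝ => ‖(S i).1‖ := by fun_prop
    have hy : Measurable fun S : Fin m → Vec d × ℝ => (S i).2 := by fun_prop
    exact (hn (measurableSet_singleton 1)).inter
      ((hy (measurableSet_singleton 1)).union (hy (measurableSet_singleton (-1))))
  have h2 : ∀ i l : Fin m, MeasurableSet
      {S : Fin m → Vec d × ℝ | |inner ℝ (S i).1 (S l).1| ≤ t} := fun i l =>
    (isClosed_le (by fun_prop) continuous_const).measurableSet
  have h3 : goodSamples m d t K =
      (⋂ i, {S : Fin m → Vec d × ℝ | ‖(S i).1‖ = 1 ∧ ((S i).2 = 1 ∨ (S i).2 = -1)}) ∩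
      ({S | negCount S ≤ K} ∩
        ⋂ i, ⋂ l, ⋂ _ : i ≠ l, {S : Fin m → Vec d × ℝ | |inner ℝ (S i).1 (S l).1| ≤ t}) := by
    ext S
    simp [goodSamples]
  rw [h3]
  exact (MeasurableSet.iInter h1).inter (((measurable_negCount m d) measurableSet_Iic).inter
    (MeasurableSet.iInter fun i => MeasurableSet.iInter fun l => MeasurableSet.iInter fun _ =>
      h2 i l))

section

variable {m d : ℕ} {p : ℝ} [IsProbabilityMeasure (unifSphere d)]
  [IsProbabilityMeasure (labelDist p)]

instance isProbabilityMeasure_sampleDist : IsProbabilityMeasure (sampleDist m d p) := by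
  unfold sampleDist
  infer_instance

theorem ae_sampleDist (m d : ℕ) (p : ℝ) [IsProbabilityMeasure (unifSphere d)]
    [IsProbabilityMeasure (labelDist p)] :
    ∀ᵐ S ∂(sampleDist m d p), ∀ i, ‖(S i).1‖ = 1 ∧ ((S i).2 = 1 ∨ (S i).2 = -1) := by
  rw [ae_all_iff]
  intro i
  have h1 : ∀ᵐ z ∂((unifSphere d).prod (labelDist p)), ‖z.1‖ = 1 ∧ (z.2 = 1 ∨ z.2 = -1) :=
    (Measure.quasiMeasurePreserving_fst.ae (ae_norm_eq_one_unifSphere d)).and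
      (Measure.quasiMeasurePreserving_snd.ae (ae_labelDist p))
  exact (measurePreserving_eval (fun _ : Fin m => (unifSphere d).prod
    (labelDist p)) i).quasiMeasurePreserving.ae h1

theorem integral_exp_neg_label (hp0 : 0 ≤ p) (c : ℝ) :
    Integrable (fun z : Vec d × ℝ => if z.2 = -1 then c else 1)
      ((unifSphere d).prod (labelDist p)) ∧
    ∫ z, (if z.2 = -1 then c else 1) ∂((unifSphere d).prod (labelDist p)) = 1 + (c - 1) * p := by
  have hm : MeasurableSet (Set.univ ×ˢ {-1} : Set (Vec d × ℝ)) :=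
    MeasurableSet.univ.prod (measurableSet_singleton _)
  have heq : (fun z : Vec d × ℝ => if z.2 = -1 then c else 1) =
      fun z => 1 + (Set.univ ×ˢ {-1} : Set (Vec d × ℝ)).indicator (fun _ => c - 1) z := by
    ext z
    by_cases hz : z.2 = -1 <;> simp [Set.indicator, hz]
  have hi : Integrable ((Set.univ ×ˢ {-1} : Set (Vec d × ℝ)).indicator (fun _ => c - 1))
      ((unifSphere d).prod (labelDist p)) := (integrable_const _).indicator hm
  rw [heq]
  refine ⟨(integrable_const _).add hi, ?_⟩
  rw [integral_add (integrable_const _) hi, integral_indicator_const _ hm, measureReal_def,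
    Measure.prod_prod, labelDist_neg_one, measure_univ, one_mul, ENNReal.toReal_ofReal hp0]
  simp [mul_comm]

/-- Chernoff's bound with exponent `3`: independence factors the exponential moment, which is at
most `exp (20mp) ≤ exp T`, and Markov's inequality divides it by `exp (3T)`. -/
theorem measureReal_negCount_ge_le (hp0 : 0 ≤ p) {T : ℝ} (hT : 20 * (m * p) ≤ T) :
    (sampleDist m d p).real {S | T ≤ negCount S} ≤ Real.exp (-T) * Real.exp (-T) := by
  obtain ⟨hi, hval⟩ := integral_exp_neg_label (d := d) hp0 (Real.exp 3)
  have hint : Integrable (fun S : Fin m → Vec d × ℝ => Real.exp (3 * negCount S))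
      (sampleDist m d p) := by
    simp only [exp_three_mul_negCount]
    exact Integrable.fintype_prod (f := fun (_ : Fin m) (z : Vec d × ℝ) =>
      if z.2 = -1 then Real.exp 3 else 1) fun _ => hi
  have hE : ∫ S, Real.exp (3 * negCount S) ∂(sampleDist m d p) =
      (1 + (Real.exp 3 - 1) * p) ^ m := by
    simp only [exp_three_mul_negCount]
    rw [sampleDist, integral_fintype_prod_eq_prod (fun (_ : Fin m) (z : Vec d × ℝ) =>
      if z.2 = -1 then Real.exp 3 else 1)]
    simp [hval]
  have hmk := mul_meas_ge_le_integral_of_nonneg (μ := sampleDist m d p)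
    (.of_forall fun S => (Real.exp_pos (3 * negCount S)).le) hint (Real.exp (3 * T))
  have hset : {S : Fin m → Vec d × ℝ | Real.exp (3 * T) ≤ Real.exp (3 * negCount S)} =
      {S | T ≤ negCount S} := by
    ext S
    simp
  rw [hset, hE] at hmk
  have he3 : Real.exp 3 - 1 ≤ 20 := by
    have h1 := Real.exp_one_lt_d9
    have h2 : Real.exp 3 = Real.exp 1 ^ 3 := by rw [← Real.exp_nat_mul]; norm_num
    have h3 : Real.exp 1 ^ 3 ≤ 2.7182818286 ^ 3 := by gcongr
    rw [h2]
    refine (sub_le_sub_right h3 1).trans ?_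
    norm_num
  have he0 : 0 ≤ Real.exp 3 - 1 := by
    have := Real.one_le_exp (show (0 : ℝ) ≤ 3 by norm_num)
    linarith
  have hpow : (1 + (Real.exp 3 - 1) * p) ^ m ≤ Real.exp T := by
    have h1 : 1 + (Real.exp 3 - 1) * p ≤ Real.exp (20 * p) := by
      have := Real.add_one_le_exp (20 * p)
      nlinarith
    calc (1 + (Real.exp 3 - 1) * p) ^ m ≤ Real.exp (20 * p) ^ m := by gcongr
      _ = Real.exp (m * (20 * p)) := by rw [← Real.exp_nat_mul]
      _ ≤ Real.exp T := Real.exp_le_exp.2 (by linarith)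
  have hexp : Real.exp (-T) * Real.exp (-T) = (Real.exp (3 * T))⁻¹ * Real.exp T := by
    rw [← Real.exp_neg, ← Real.exp_add, ← Real.exp_add]
    congr 1
    ring
  rw [hexp, ← div_eq_inv_mul, le_div_iff₀' (Real.exp_pos _)]
  exact hmk.trans hpow

theorem sampleDist_abs_inner_le (hd : 0 < d) {t : ℝ} (ht : 0 ≤ t) (ht2 : t ^ 2 ≤ 1 / 2)
    {i l : Fin m} (hil : i ≠ l) :
    sampleDist m d p {S | t < |inner ℝ (S i).1 (S l).1|} ≤
      ENNReal.ofReal (2 * Real.exp (-(d * t ^ 2 / 2))) := by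
  have hX : ∀ i : Fin m, MeasurePreserving (fun S : Fin m → Vec d × ℝ => (S i).1)
      (sampleDist m d p) (unifSphere d) := fun i =>
    measurePreserving_fst.comp (measurePreserving_eval (fun _ : Fin m => (unifSphere d).prod
      (labelDist p)) i)
  have hind : ProbabilityTheory.IndepFun (fun S : Fin m → Vec d × ℝ => (S i).1)
      (fun S => (S l).1) (sampleDist m d p) :=
    (ProbabilityTheory.iIndepFun_pi (μ := fun _ : Fin m => (unifSphere d).prod (labelDist p))
      (X := fun _ z => z.1) fun _ => measurable_fst.aemeasurable).indepFun hil
  have hmap := (ProbabilityTheory.indepFun_iff_map_prod_eq_prod_map_map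
    (hX i).measurable.aemeasurable (hX l).measurable.aemeasurable).1 hind
  rw [(hX i).map_eq, (hX l).map_eq] at hmap
  have hm : MeasurableSet {q : Vec d × Vec d | t < |inner ℝ q.1 q.2|} :=
    (isOpen_lt continuous_const (by fun_prop)).measurableSet
  have h1 : sampleDist m d p {S | t < |inner ℝ (S i).1 (S l).1|} =
      ((unifSphere d).prod (unifSphere d)) {q | t < |inner ℝ q.1 q.2|} := by
    rw [← hmap, Measure.map_apply ((hX i).measurable.prodMk (hX l).measurable) hm]
    rfl
  rw [h1, Measure.prod_apply hm]
  have h2 : ∀ᵐ u ∂(unifSphere d), unifSphere d (Prod.mk u ⁻¹' {q | t < |inner ℝ q.1 q.2|}) ≤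
      ENNReal.ofReal (2 * Real.exp (-(d * t ^ 2 / 2))) := by
    filter_upwards [ae_norm_eq_one_unifSphere d] with u hu
    exact unifSphere_abs_inner_le hd hu ht ht2
  refine (lintegral_mono_ae h2).trans ?_
  simp

theorem sampleDist_exists_abs_inner_le (hd : 0 < d) {t : ℝ} (ht : 0 ≤ t) (ht2 : t ^ 2 ≤ 1 / 2) :
    sampleDist m d p {S | ∃ i l, i ≠ l ∧ t < |inner ℝ (S i).1 (S l).1|} ≤
      ENNReal.ofReal (m ^ 2 * (2 * Real.exp (-(d * t ^ 2 / 2)))) := by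
  have hsub : {S : Fin m → Vec d × ℝ | ∃ i l, i ≠ l ∧ t < |inner ℝ (S i).1 (S l).1|} ⊆
      ⋃ q ∈ (Finset.univ : Finset (Fin m)).offDiag, {S | t < |inner ℝ (S q.1).1 (S q.2).1|} := by
    rintro S ⟨i, l, hil, h⟩
    simp only [Set.mem_iUnion]
    exact ⟨(i, l), by simpa using hil, h⟩
  refine (measure_mono hsub).trans ((measure_biUnion_finset_le _ _).trans ?_)
  refine (Finset.sum_le_card_nsmul _ _ _ fun q hq =>
    sampleDist_abs_inner_le hd ht ht2 (by simpa using hq)).trans ?_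
  rw [ENNReal.ofReal_mul (p := (m : ℝ) ^ 2) (by positivity), nsmul_eq_mul]
  refine mul_le_mul' ?_ le_rfl
  rw [Finset.offDiag_card, Finset.card_univ, Fintype.card_fin,
    ENNReal.ofReal_pow (Nat.cast_nonneg m), ENNReal.ofReal_natCast, sq]
  exact_mod_cast Nat.sub_le _ _

theorem le_sampleDist_goodSamples (hd : 0 < d) (hp0 : 0 ≤ p) {t K δ : ℝ} (hδ : 0 < δ)
    (ht : 0 ≤ t) (ht2 : t ^ 2 ≤ 1 / 2)
    (hort : m = 1 ∨ m ^ 2 * (2 * Real.exp (-(d * t ^ 2 / 2))) ≤ δ / 2)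
    (hK : 20 * (m * p) ≤ K) (hKδ : Real.log (1 / δ) ≤ K) :
    ENNReal.ofReal (1 - δ) ≤ sampleDist m d p (goodSamples m d t K) := by
  set μ := sampleDist m d p with hμ
  have hneg : μ {S | K < negCount S} ≤ ENNReal.ofReal (δ / 2) := by
    -- The count is an integer, so exceeding `K ≥ 0` means being at least `1`. With the threshold
    -- `max 1 K`, one factor `exp (-T)` is at most `1/2` and the other at most `δ`.
    have hsub : {S : Fin m → Vec d × ℝ | K < negCount S} ⊆ {S | max 1 K ≤ negCount S} := by
      intro S (hS : K < negCount S)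
      refine max_le ?_ hS.le
      have hK0 : 0 ≤ K := le_trans (by positivity) hK
      have h1 : negCount S =
          ((Finset.univ.filter fun i => (S i).2 = -1).card : ℝ) := by
        rw [negCount, Finset.sum_boole]
      have h2 : 0 < negCount S := hK0.trans_lt hS
      rw [h1] at h2 ⊢
      exact_mod_cast h2
    refine (measure_mono hsub).trans ?_
    rw [← ofReal_measureReal (measure_ne_top _ _)]
    apply ENNReal.ofReal_le_ofReal
    refine (measureReal_negCount_ge_le hp0 (hK.trans (le_max_right _ _))).trans ?_
    have h1 : Real.exp (-max 1 K) ≤ 1 / 2 := by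
      have h2 : Real.exp (-max 1 K) ≤ Real.exp (-1) :=
        Real.exp_le_exp.2 (neg_le_neg (le_max_left _ _))
      have h3 : Real.exp (-1) ≤ 1 / 2 := by
        rw [Real.exp_neg, ← one_div]
        apply one_div_le_one_div_of_le (by norm_num)
        have := Real.add_one_le_exp 1
        linarith
      exact h2.trans h3
    have h2 : Real.exp (-max 1 K) ≤ δ := by
      rw [← Real.le_log_iff_exp_le hδ]
      rw [one_div, Real.log_inv] at hKδ
      linarith [le_max_right 1 K]
    nlinarith [Real.exp_pos (-max 1 K)]
  have hinn : μ {S | ∃ i l, i ≠ l ∧ t < |inner ℝ (S i).1 (S l).1|} ≤ ENNReal.ofReal (δ / 2) := by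
    rcases hort with h1 | h1
    · subst h1
      have : {S : Fin 1 → Vec d × ℝ | ∃ i l, i ≠ l ∧ t < |inner ℝ (S i).1 (S l).1|} = ∅ := by
        ext S
        simp only [Set.mem_ofPred_eq, Set.mem_empty_iff_false, iff_false]
        rintro ⟨i, l, hil, -⟩
        exact hil (Subsingleton.elim _ _)
      rw [this, measure_empty]
      exact zero_le
    · exact (sampleDist_exists_abs_inner_le hd ht ht2).trans (ENNReal.ofReal_le_ofReal h1)
  have hcompl : μ (goodSamples m d t K)ᶜ ≤ ENNReal.ofReal δ := by
    have hsub : (goodSamples m d t K)ᶜ ⊆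
        {S | ¬ ∀ i, ‖(S i).1‖ = 1 ∧ ((S i).2 = 1 ∨ (S i).2 = -1)} ∪
          ({S | K < negCount S} ∪ {S | ∃ i l, i ≠ l ∧ t < |inner ℝ (S i).1 (S l).1|}) := by
      intro S hS
      by_contra hc
      simp only [Set.mem_union, Set.mem_ofPred_eq, not_or, not_not, not_lt, not_exists,
        not_and] at hc
      exact hS ⟨hc.1, hc.2.1, hc.2.2⟩
    refine (measure_mono hsub).trans ((measure_union_le _ _).trans ?_)
    rw [ae_iff.1 (ae_sampleDist m d p), zero_add]
    refine (measure_union_le _ _).trans ((add_le_add hneg hinn).trans_eq ?_)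
    rw [← ENNReal.ofReal_add (by positivity) (by positivity), add_halves]
  have h1 : μ (goodSamples m d t K) = 1 - μ (goodSamples m d t K)ᶜ := by
    rw [← prob_compl_eq_one_sub (measurableSet_goodSamples m d t K).compl, compl_compl]
  rw [h1, ENNReal.ofReal_sub _ hδ.le, ENNReal.ofReal_one]
  exact tsub_le_tsub_left hcompl 1

end

end BenignKKT

/-! ### Clarke subdifferential of the network -/

namespace BenignKKT

open WithLp

variable {n d : ℕ}

noncomputable section

/-- The preactivation `w_j · x + b_j` of the `j`-th neuron. -/
def preact (θ : Params n d) (x : Vec d) (j : Fin n) : ℝ :=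
  inner ℝ (θ j).fst x + (θ j).snd

/-- For `z ≤ 0` the function vanishes on one side of `0`, chosen by the sign of `c`. A two-sided
derivative, if it exists, must then be `0`, so the kink needs no separate treatment. -/
theorem hasDerivAt_relu_line {z c L : ℝ} (hL : HasDerivAt (fun r : ℝ => relu (z + r * c)) L 0) :
    L = if 0 < z then c else 0 := by
  have hlin : HasDerivAt (fun r : ℝ => z + r * c) c 0 := by
    simpa using ((hasDerivAt_id (0 : ℝ)).mul_const c).const_add z
  have htend : Tendsto (fun r : ℝ => z + r * c) (𝓝 0) (𝓝 z) := by
    simpa using hlin.continuousAt.tendsto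
  split_ifs with hz
  · refine hL.unique (hlin.congr_of_eventuallyEq ?_)
    filter_upwards [htend.eventually (lt_mem_nhds hz)] with r hr
    exact max_eq_right hr.le
  · rcases le_total 0 c with hc | hc
    · refine (uniqueDiffWithinAt_Iic (0 : ℝ)).eq_deriv _ hL.hasDerivWithinAt
        ((hasDerivWithinAt_const (0 : ℝ) _ (0 : ℝ)).congr (fun r (hr : r ≤ 0) => ?_) ?_)
      · exact max_eq_left (by nlinarith)
      · exact max_eq_left (by nlinarith)
    · refine (uniqueDiffWithinAt_Ici (0 : ℝ)).eq_deriv _ hL.hasDerivWithinAt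
        ((hasDerivWithinAt_const (0 : ℝ) _ (0 : ℝ)).congr (fun r (hr : 0 ≤ r) => ?_) ?_)
      · exact max_eq_left (by nlinarith)
      · exact max_eq_left (by nlinarith)

theorem hasDerivAt_line_of_differentiableAt {E : Type*} [NormedAddCommGroup E]
    [InnerProductSpace ℝ E] [CompleteSpace E] {f : E → ℝ} {x : E} (hf : DifferentiableAt ℝ f x)
    (q : E) : HasDerivAt (fun r : ℝ => f (x + r • q)) (inner ℝ (gradient f x) q) 0 := by
  simpa [HasLineDerivAt] using hf.hasGradientAt.hasFDerivAt.hasLineDerivAt q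

/-- The parameters that vanish outside the `j`-th neuron. -/
def block (j : Fin n) (q : WithLp 2 (Vec d × ℝ)) : Params n d := PiLp.single 2 j q

theorem block_same (j : Fin n) (q : WithLp 2 (Vec d × ℝ)) : block j q j = q :=
  Pi.single_eq_same (M := fun _ : Fin n => WithLp 2 (Vec d × ℝ)) j q

theorem block_of_ne {j k : Fin n} (h : k ≠ j) (q : WithLp 2 (Vec d × ℝ)) : block j q k = 0 :=
  Pi.single_eq_of_ne (M := fun _ : Fin n => WithLp 2 (Vec d × ℝ)) h q

theorem inner_block (g : Params n d) (j : Fin n) (q : WithLp 2 (Vec d × ℝ)) :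
    inner ℝ g (block j q) = inner ℝ (g j) q := by
  rw [PiLp.inner_apply, Finset.sum_eq_single j]
  · rw [block_same]
  · intro k _ hk
    rw [block_of_ne hk, inner_zero_right]
  · simp

theorem network_add_block (v : Fin n → ℝ) (θ : Params n d) (x : Vec d) (j : Fin n)
    (q : WithLp 2 (Vec d × ℝ)) (r : ℝ) :
    network v (θ + r • block j q) x =
      (network v θ x - v j * relu (preact θ x j)) +
        v j * relu (preact θ x j + r * inner ℝ q (toLp 2 (x, (1 : ℝ)))) := by
  simp only [network]
  rw [← Finset.add_sum_erase _ _ (Finset.mem_univ j), ← Finset.add_sum_erase Finset.univ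
    (fun k => v k * relu (inner ℝ (θ k).fst x + (θ k).snd)) (Finset.mem_univ j)]
  have h1 : ∀ k ∈ Finset.univ.erase j,
      v k * relu (inner ℝ ((θ + r • block j q) k).fst x
        + ((θ + r • block j q) k).snd) =
      v k * relu (inner ℝ (θ k).fst x + (θ k).snd) := by
    intro k hk
    rw [PiLp.add_apply, PiLp.smul_apply, block_of_ne (Finset.ne_of_mem_erase hk), smul_zero,
      add_zero]
  rw [Finset.sum_congr rfl h1]
  have h2 : inner ℝ ((θ + r • block j q) j).fst x
        + ((θ + r • block j q) j).snd =
      preact θ x j + r * inner ℝ q (toLp 2 (x, (1 : ℝ))) := by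
    rw [PiLp.add_apply, PiLp.smul_apply, block_same]
    simp [preact, inner_add_left, inner_smul_left, WithLp.prod_inner_apply]
    ring
  rw [h2, preact]
  ring

/-- Moving only the `j`-th neuron changes a single ReLU term, so differentiability of the whole
network makes that term differentiable along every line in the block. -/
theorem gradient_network_apply {v : Fin n → ℝ} {θ : Params n d} {x : Vec d}
    (hv : ∀ j, v j ≠ 0)
    (hd : DifferentiableAt ℝ (fun θ' : Params n d => network v θ' x) θ) (j : Fin n) :
    gradient (fun θ' : Params n d => network v θ' x) θ j =
      (v j * if 0 < preact θ x j then 1 else 0) • toLp 2 (x, (1 : ℝ)) := by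
  refine ext_inner_right ℝ fun q => ?_
  have h1 := hasDerivAt_line_of_differentiableAt hd (block j q)
  rw [inner_block] at h1
  simp only [network_add_block] at h1
  have h3 := ((h1.sub_const (network v θ x - v j * relu (preact θ x j))).const_mul (v j)⁻¹)
  have h4 := hasDerivAt_relu_line (z := preact θ x j)
    (c := inner ℝ q (toLp 2 (x, (1 : ℝ)))) (h3.congr_of_eventuallyEq (.of_forall fun r => by
    beta_reduce
    rw [add_sub_cancel_left, inv_mul_cancel_left₀ (hv j)]))
  have h5 := congrArg (v j * ·) h4
  simp only [mul_inv_cancel_left₀ (hv j)] at h5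
  rw [h5, inner_smul_left, real_inner_comm]
  split_ifs <;> simp

/-- The generalized gradients of the network in its parameters: the `j`-th block is
`v_j s_j (x, 1)`, where `s_j` is a subderivative of the ReLU at the `j`-th preactivation. -/
def subgradients (v : Fin n → ℝ) (θ : Params n d) (x : Vec d) : Set (Params n d) :=
  {g | ∃ s : Fin n → ℝ, ∀ j, 0 ≤ s j ∧ s j ≤ 1 ∧ (0 < preact θ x j → s j = 1) ∧
    (preact θ x j < 0 → s j = 0) ∧ g j = (v j * s j) • toLp 2 (x, (1 : ℝ))}

theorem convex_subgradients (v : Fin n → ℝ) (θ : Params n d) (x : Vec d) :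
    Convex ℝ (subgradients v θ x) := by
  rintro g ⟨s, hs⟩ g' ⟨s', hs'⟩ a b ha hb hab
  refine ⟨fun j => a * s j + b * s' j, fun j => ?_⟩
  obtain ⟨h0, h1, hp, hn, hg⟩ := hs j
  obtain ⟨h0', h1', hp', hn', hg'⟩ := hs' j
  refine ⟨by positivity, by nlinarith, fun h => ?_, fun h => ?_, ?_⟩
  · simp only [hp h, hp' h]; linarith
  · simp only [hn h, hn' h]; ring
  · rw [PiLp.add_apply, PiLp.smul_apply, PiLp.smul_apply, hg, hg', smul_smul, smul_smul, ← add_smul]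
    congr 1
    ring

theorem continuous_preact (x : Vec d) (j : Fin n) :
    Continuous fun θ : Params n d => preact θ x j := by
  unfold preact
  have h1 : Continuous fun θ : Params n d => (θ j).fst :=
    (WithLp.continuous_fst (p := 2) (α := Vec d) (β := ℝ)).comp (PiLp.continuous_apply 2 _ j)
  have h2 : Continuous fun θ : Params n d => (θ j).snd :=
    (WithLp.continuous_snd (p := 2) (α := Vec d) (β := ℝ)).comp (PiLp.continuous_apply 2 _ j)
  fun_prop

/-- Only this inclusion is needed: the target is convex, and limits of gradients lie in it because
activation indicators are eventually constant where the preactivation is nonzero. -/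
theorem clarkeSubdifferential_network_subset {v : Fin n → ℝ} (hv : ∀ j, v j ≠ 0)
    (θ : Params n d) (x : Vec d) :
    clarkeSubdifferential (fun θ' : Params n d => network v θ' x) θ ⊆ subgradients v θ x := by
  refine convexHull_min ?_ (convex_subgradients v θ x)
  rintro g ⟨u, hu, hdiff, hg⟩
  set S : ℕ → Fin n → ℝ := fun k j => if 0 < preact (u k) x j then 1 else 0 with hS
  have hgj : ∀ j, Tendsto (fun k => (v j * S k j) • toLp 2 (x, (1 : ℝ))) atTop (𝓝 (g j)) := by
    intro j
    have := ((PiLp.continuous_apply 2 _ j).tendsto g).comp hg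
    refine this.congr fun k => ?_
    exact gradient_network_apply hv (hdiff k) j
  have hs : ∀ j, Tendsto (fun k => S k j) atTop (𝓝 ((v j)⁻¹ * (g j).snd)) := by
    intro j
    have := (((WithLp.continuous_snd (p := 2) (α := Vec d) (β := ℝ)).tendsto _).comp
      (hgj j)).const_mul (v j)⁻¹
    refine this.congr fun k => ?_
    simp [inv_mul_cancel_left₀ (hv j)]
  have hpre : ∀ j, Tendsto (fun k => preact (u k) x j) atTop (𝓝 (preact θ x j)) := fun j =>
    ((continuous_preact x j).tendsto θ).comp hu
  -- The bias coordinate of `(x, 1)` is `1`, so the subderivative can be read off from that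
  -- coordinate of `g j`.
  refine ⟨fun j => (v j)⁻¹ * (g j).snd, fun j => ⟨?_, ?_, fun h => ?_, fun h => ?_, ?_⟩⟩
  · exact ge_of_tendsto' (hs j) fun k => by simp only [hS]; split_ifs <;> norm_num
  · exact le_of_tendsto' (hs j) fun k => by simp only [hS]; split_ifs <;> norm_num
  · refine tendsto_nhds_unique (hs j) (tendsto_const_nhds.congr' ?_)
    filter_upwards [(hpre j).eventually (lt_mem_nhds h)] with k hk
    simp [hS, hk]
  · refine tendsto_nhds_unique (hs j) (tendsto_const_nhds.congr' ?_)
    filter_upwards [(hpre j).eventually (gt_mem_nhds h)] with k hk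
    simp [hS, hk.le]
  · exact tendsto_nhds_unique (hgj j) (((hs j).const_mul (v j)).smul_const _)

end

end BenignKKT

/-! ### Approximate KKT systems for nearly orthonormal inputs -/

namespace BenignKKT

theorem relu_nonneg (z : ℝ) : 0 ≤ relu z := le_max_left _ _

theorem le_relu (z : ℝ) : z ≤ relu z := le_max_right _ _

theorem relu_le {z c : ℝ} (h0 : 0 ≤ c) (h : z ≤ c) : relu z ≤ c := max_le h0 h

/-- The KKT conditions for training data whose inputs are orthonormal up to an error `η` in the
preactivations: `z i j` is the preactivation of neuron `j` at input `i`, `a i j` is the multiplier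
of `i` times the subderivative of the ReLU at `z i j`, and `b j` is the bias. -/
structure ApproxKKT {I J : Type*} [Fintype I] [Fintype J] (y : I → ℝ) (v : J → ℝ) (lam : I → ℝ)
    (a z : I → J → ℝ) (b : J → ℝ) (η : ℝ) : Prop where
  label : ∀ i, y i = 1 ∨ y i = -1
  weight : ∀ j, v j = 1 ∨ v j = -1
  nonneg : ∀ i j, 0 ≤ a i j
  le_lam : ∀ i j, a i j ≤ lam i
  active : ∀ i j, 0 < z i j → a i j = lam i
  inactive : ∀ i j, z i j < 0 → a i j = 0
  bias : ∀ j, b j = ∑ i, y i * v j * a i j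
  error : ∀ i j, |z i j - (y i * v j * a i j + b j)| ≤ η
  margin : ∀ i, 1 ≤ y i * ∑ j, v j * relu (z i j)
  slack : ∀ i, lam i * (y i * ∑ j, v j * relu (z i j) - 1) = 0

namespace ApproxKKT

variable {I J : Type*} [Fintype I] [Fintype J] {y : I → ℝ} {v : J → ℝ} {lam : I → ℝ}
  {a z : I → J → ℝ} {b : J → ℝ} {η : ℝ}

theorem label_mul_weight (h : ApproxKKT y v lam a z b η) (i : I) (j : J) :
    y i * v j = 1 ∨ y i * v j = -1 := by
  rcases h.label i with h1 | h1 <;> rcases h.weight j with h2 | h2 <;> simp [h1, h2]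

theorem lam_nonneg [Nonempty J] (h : ApproxKKT y v lam a z b η) (i : I) : 0 ≤ lam i :=
  (h.nonneg i (Classical.arbitrary J)).trans (h.le_lam i _)

/-- A larger coefficient would make the preactivation negative, where the subderivative vanishes. -/
theorem opposite_le (h : ApproxKKT y v lam a z b η) {i : I} {j : J} (hij : y i * v j = -1) :
    a i j = 0 ∨ a i j ≤ b j + η := by
  by_contra! hc
  have h1 := abs_le.1 (h.error i j)
  rw [hij] at h1
  exact hc.1 (h.inactive i j (by linarith [h1.2, hc.2]))

/-- With `b j ≤ η`, opposing coefficients are at most `2η`, so every summand of the bias is at least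
`-2η`. Since the bias is small, no single summand can be large. -/
theorem relu_le_of_dead [Nonempty I] (h : ApproxKKT y v lam a z b η) (hη : 0 ≤ η) (i : I) {j : J}
    (hj : b j ≤ η) : relu (z i j) ≤ 5 * Fintype.card I * η := by
  have hm : (1 : ℝ) ≤ Fintype.card I := by exact_mod_cast Fintype.card_pos
  have hopp : ∀ l, y l * v j = -1 → a l j ≤ 2 * η := fun l hl => by
    rcases h.opposite_le hl with h2 | h2 <;> linarith
  have hterm : ∀ l, -(2 * η) ≤ y l * v j * a l j := fun l => by
    rcases h.label_mul_weight l j with hl | hl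
    · rw [hl, one_mul]; linarith [h.nonneg l j]
    · rw [hl]; linarith [hopp l hl]
  have h1 := (abs_le.1 (h.error i j)).2
  have hle : y i * v j * a i j ≤ b j + 2 * η * Fintype.card I := by
    have hb := h.bias j
    have : ∑ l, (y l * v j * a l j + 2 * η) = b j + 2 * η * Fintype.card I := by
      rw [Finset.sum_add_distrib, ← hb]
      simp [mul_comm]
    have h2 := Finset.single_le_sum (f := fun l => y l * v j * a l j + 2 * η)
      (fun l _ => by linarith [hterm l]) (Finset.mem_univ i)
    rw [this] at h2
    linarith
  refine relu_le (by positivity) ?_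
  nlinarith

theorem same_eq_of_alive (h : ApproxKKT y v lam a z b η) {i : I} {j : J} (hj : η < b j)
    (hij : y i * v j = 1) : a i j = lam i := by
  have h1 := (abs_le.1 (h.error i j)).1
  rw [hij] at h1
  exact h.active i j (by linarith [h.nonneg i j])

theorem opposite_ge (h : ApproxKKT y v lam a z b η) {i : I} {j : J} (hij : y i * v j = -1) :
    a i j = lam i ∨ b j - η ≤ a i j := by
  by_contra! hc
  have h1 := (abs_le.1 (h.error i j)).1
  rw [hij] at h1
  exact hc.1 (h.active i j (by linarith [hc.2]))

/-- The network output at inputs orthogonal to the data, up to errors. -/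
noncomputable def biasOutput (v b : J → ℝ) (η : ℝ) : ℝ := ∑ j, if η < b j then v j * b j else 0

-- For a live neuron, an agreeing example gives about `λ_i + b_j`, and an opposing one at least
-- about `b_j - λ_i` before the sign. Either way, the signed output exceeds the signed bias by at
-- most about `λ_i`.
open Classical in
theorem term_le [Nonempty I] (h : ApproxKKT y v lam a z b η) (hη : 0 ≤ η) (i : I) (j : J) :
    y i * v j * relu (z i j) ≤
      lam i + y i * (if η < b j then v j * b j else 0) + 5 * Fintype.card I * η := by
  have : Nonempty J := ⟨j⟩
  have hm : (1 : ℝ) ≤ Fintype.card I := by exact_mod_cast Fintype.card_pos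
  have hl := h.lam_nonneg i
  have h1 := abs_le.1 (h.error i j)
  have hr := relu_nonneg (z i j)
  have hmη : η ≤ Fintype.card I * η := by nlinarith
  split_ifs with hj
  · rw [← mul_assoc]
    rcases h.label_mul_weight i j with hij | hij
    · rw [hij] at h1 ⊢
      have := relu_le (z := z i j) (c := lam i + b j + η) (by linarith)
        (by linarith [h.le_lam i j])
      linarith
    · rw [hij] at h1 ⊢
      linarith [le_relu (z i j), h.le_lam i j]
  · have := h.relu_le_of_dead hη i (not_lt.1 hj)
    rcases h.label_mul_weight i j with hij | hij <;> rw [hij] <;> linarith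

-- Complement of `term_le`: agreeing live neurons really contribute the full `λ_i`, while opposing
-- ones output at most about `b_j`.
open Classical in
theorem le_term [Nonempty I] (h : ApproxKKT y v lam a z b η) (hη : 0 ≤ η) (i : I) (j : J) :
    (if η < b j ∧ y i * v j = 1 then lam i else 0)
      + y i * (if η < b j then v j * b j else 0) - 5 * Fintype.card I * η ≤
      y i * v j * relu (z i j) := by
  have : Nonempty J := ⟨j⟩
  have hm : (1 : ℝ) ≤ Fintype.card I := by exact_mod_cast Fintype.card_pos
  have hl := h.lam_nonneg i
  have h1 := abs_le.1 (h.error i j)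
  have hr := relu_nonneg (z i j)
  have hmη : η ≤ Fintype.card I * η := by nlinarith
  by_cases hj : η < b j
  · simp only [hj, true_and, if_true]
    rw [← mul_assoc]
    rcases h.label_mul_weight i j with hij | hij
    · have ha := h.same_eq_of_alive hj hij
      rw [hij, ha] at h1
      rw [hij, if_pos rfl]
      linarith [le_relu (z i j)]
    · rw [hij] at h1 ⊢
      rw [if_neg (by norm_num)]
      have := relu_le (z := z i j) (c := b j + η) (by linarith) (by linarith [h.nonneg i j])
      linarith
  · simp only [hj, false_and, if_false]
    have := h.relu_le_of_dead hη i (not_lt.1 hj)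
    rcases h.label_mul_weight i j with hij | hij <;> rw [hij] <;> nlinarith

theorem margin_le [Nonempty I] (h : ApproxKKT y v lam a z b η) (hη : 0 ≤ η) (i : I) :
    1 ≤ Fintype.card J * lam i + y i * biasOutput v b η +
      5 * Fintype.card J * Fintype.card I * η := by
  have h1 := h.margin i
  rw [Finset.mul_sum] at h1
  refine h1.trans ?_
  calc ∑ j, y i * (v j * relu (z i j)) ≤ ∑ j, (lam i + y i * (if η < b j then v j * b j else 0)
        + 5 * Fintype.card I * η) :=
        Finset.sum_le_sum fun j _ => by rw [← mul_assoc]; exact h.term_le hη i j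
    _ = _ := by
      rw [Finset.sum_add_distrib, Finset.sum_add_distrib, ← Finset.mul_sum, biasOutput]
      simp
      ring

open Classical in
/-- The neurons with a significant bias whose output weight is `s`. -/
noncomputable def alive (v b : J → ℝ) (η s : ℝ) : Finset J := {j | η < b j ∧ v j = s}

theorem mem_alive {v b : J → ℝ} {η s : ℝ} {j : J} :
    j ∈ alive v b η s ↔ η < b j ∧ v j = s := by
  simp [alive]

theorem mul_eq_one_iff_weight_eq (h : ApproxKKT y v lam a z b η) (i : I) (j : J) :
    y i * v j = 1 ↔ v j = y i := by
  rcases h.label i with h1 | h1 <;> rcases h.weight j with h2 | h2 <;> rw [h1, h2] <;> norm_num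

/-- A nonzero multiplier makes the margin tight, so the lower bounds of `le_term` sum to at most
`1`. -/
theorem card_alive_mul_lam_le [Nonempty I] (h : ApproxKKT y v lam a z b η) (hη : 0 ≤ η) {i : I}
    (hi : lam i ≠ 0) :
    (alive v b η (y i)).card * lam i ≤ 1 - y i * biasOutput v b η +
      5 * Fintype.card J * Fintype.card I * η := by
  classical
  have h1 : y i * ∑ j, v j * relu (z i j) = 1 := by
    have := (mul_eq_zero.1 (h.slack i)).resolve_left hi
    linarith
  rw [Finset.mul_sum] at h1
  have h2 := Finset.sum_le_sum fun j (_ : j ∈ Finset.univ) => h.le_term hη i j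
  rw [Finset.sum_sub_distrib, Finset.sum_add_distrib, ← Finset.mul_sum, ← biasOutput] at h2
  simp only [mul_assoc (y i), h1] at h2
  have h3 : ∑ j, (if η < b j ∧ y i * v j = 1 then lam i else 0) =
      (alive v b η (y i)).card * lam i := by
    rw [← Finset.sum_filter, Finset.sum_const, nsmul_eq_mul, alive]
    simp only [h.mul_eq_one_iff_weight_eq]
  rw [h3] at h2
  simp at h2
  linarith

/-- Otherwise the neurons helping example `i` would all be dead, and their total could not reach the
margin `1`. -/
theorem alive_nonempty [Nonempty I] (h : ApproxKKT y v lam a z b η) (hη : 0 ≤ η)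
    (hE : 5 * Fintype.card J * Fintype.card I * η < 1) (i : I) :
    (alive v b η (y i)).Nonempty := by
  by_contra hc
  rw [Finset.not_nonempty_iff_eq_empty] at hc
  have h1 := h.margin i
  rw [Finset.mul_sum] at h1
  have h2 : ∑ j, y i * (v j * relu (z i j)) ≤ ∑ _j : J, 5 * Fintype.card I * η := by
    refine Finset.sum_le_sum fun j _ => ?_
    have hr := relu_nonneg (z i j)
    rw [← mul_assoc]
    rcases h.label_mul_weight i j with hij | hij
    · have hj : ¬ η < b j := fun hj => by
        have : j ∈ alive v b η (y i) := mem_alive.2 ⟨hj, (h.mul_eq_one_iff_weight_eq i j).1 hij⟩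
        simp [hc] at this
      rw [hij, one_mul]
      exact h.relu_le_of_dead hη i (not_lt.1 hj)
    · rw [hij]
      have : 0 ≤ 5 * Fintype.card I * η := by positivity
      linarith
  simp at h2
  linarith

theorem biasOutput_eq (h : ApproxKKT y v lam a z b η) :
    biasOutput v b η = ∑ j ∈ alive v b η 1, b j - ∑ j ∈ alive v b η (-1), b j := by
  classical
  rw [biasOutput, alive, alive, Finset.sum_filter, Finset.sum_filter, ← Finset.sum_sub_distrib]
  refine Finset.sum_congr rfl fun j _ => ?_
  rcases h.weight j with hj | hj <;> by_cases hb : η < b j <;> simp [hj, hb] <;> norm_num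

/-- The inputs with a given label. -/
noncomputable def withLabel (y : I → ℝ) (s : ℝ) : Finset I := by classical exact {i | y i = s}

theorem mem_withLabel {y : I → ℝ} {s : ℝ} {i : I} : i ∈ withLabel y s ↔ y i = s := by
  simp [withLabel]

theorem sum_eq_withLabel (h : ApproxKKT y v lam a z b η) (f : I → ℝ) :
    ∑ i, f i = ∑ i ∈ withLabel y 1, f i + ∑ i ∈ withLabel y (-1), f i := by
  classical
  rw [withLabel, withLabel, Finset.sum_filter, Finset.sum_filter, ← Finset.sum_add_distrib]
  refine Finset.sum_congr rfl fun i _ => ?_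
  rcases h.label i with hi | hi <;> simp [hi] <;> norm_num

theorem card_withLabel (h : ApproxKKT y v lam a z b η) :
    ((withLabel y 1).card : ℝ) + (withLabel y (-1)).card = Fintype.card I := by
  have := h.sum_eq_withLabel fun _ => 1
  simp at this
  linarith

set_option maxHeartbeats 1000000 in
theorem biasOutput_gt [Nonempty I] [Nonempty J] (h : ApproxKKT y v lam a z b η) (hη : 0 ≤ η)
    (hE : 5 * Fintype.card J * Fintype.card I * η ≤ 1 / (10 * Fintype.card J))
    (hk : ((withLabel y (-1)).card : ℝ) ≤ Fintype.card I / (20 * Fintype.card J)) :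
    5 * Fintype.card J * Fintype.card I * η < biasOutput v b η := by
  by_contra! hD
  set n : ℝ := (Fintype.card J : ℝ) with hn
  set m : ℝ := (Fintype.card I : ℝ) with hm
  have hn1 : 1 ≤ n := by rw [hn]; exact_mod_cast Fintype.card_pos
  have hm1 : 1 ≤ m := by rw [hm]; exact_mod_cast Fintype.card_pos
  set E := 5 * n * m * η with hEdef
  set D := biasOutput v b η with hDdef
  have hcard := h.card_withLabel
  set mp : ℝ := ((withLabel y 1).card : ℝ) with hmp
  set k : ℝ := ((withLabel y (-1)).card : ℝ) with hkdef
  rw [← hm] at hcard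
  set np := alive v b η 1 with hnp
  set nm := alive v b η (-1) with hnm
  set q : ℝ := 1 / n with hq
  have hq0 : 0 < q := by positivity
  have hqn : q * n = 1 := by rw [hq]; field_simp
  have hq1 : q ≤ 1 := by rw [hq, div_le_one (by positivity)]; exact hn1
  have hE' : E ≤ q / 10 := hE.trans_eq (by rw [hq]; field_simp)
  have hk' : k ≤ m * q / 20 := hk.trans_eq (by rw [hq]; field_simp)
  have hE0 : 0 ≤ E := by positivity
  have hk0 : 0 ≤ k := by positivity
  have hmq : m * q ≤ m := by nlinarith
  have hmp19 : 19 / 20 * m ≤ mp := by linarith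
  -- multipliers of the two classes
  have hlamp : ∀ i ∈ withLabel y 1, q / 2 ≤ lam i := fun i hi => by
    have h1 := h.margin_le hη i
    rw [mem_withLabel.1 hi, ← hn, ← hm, ← hDdef, ← hEdef] at h1
    have h2 : 1 / 2 ≤ n * lam i := by linarith
    nlinarith
  have hlamm : ∀ i ∈ withLabel y (-1), nm.card * lam i ≤ 3 / 2 := fun i hi => by
    by_cases h0 : lam i = 0
    · rw [h0]; norm_num
    · have h1 := h.card_alive_mul_lam_le hη h0
      rw [mem_withLabel.1 hi, ← hn, ← hm, ← hDdef, ← hEdef] at h1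
      linarith
  have hlamm1 : ∀ i ∈ withLabel y (-1), lam i ≤ 3 / 2 := fun i hi => by
    have h1 := h.alive_nonempty hη (by rw [← hn, ← hm, ← hEdef]; linarith) i
    rw [mem_withLabel.1 hi] at h1
    have h2 : (1 : ℝ) ≤ nm.card := Nat.one_le_cast.2 h1.card_pos
    nlinarith [hlamm i hi, h.lam_nonneg i]
  set Lm := ∑ i ∈ withLabel y (-1), lam i with hLm
  have hLm1 : Lm ≤ 3 / 2 * k := by
    have := Finset.sum_le_card_nsmul _ _ _ hlamm1
    rw [nsmul_eq_mul] at this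
    linarith
  have hLm2 : nm.card * Lm ≤ 3 / 2 * k := by
    have := Finset.sum_le_card_nsmul _ _ _ hlamm
    rw [nsmul_eq_mul, ← Finset.mul_sum] at this
    linarith
  -- the positive side is alive and has large biases
  have hbp : ∀ j ∈ np, 2 / 5 * (m * q) ≤ b j := fun j hj => by
    obtain ⟨hj1, hj2⟩ := mem_alive.1 hj
    have h1 := h.bias j
    rw [h.sum_eq_withLabel] at h1
    have h2 : mp * (q / 2) ≤ ∑ i ∈ withLabel y 1, y i * v j * a i j := by
      rw [hmp, ← nsmul_eq_mul]
      refine Finset.card_nsmul_le_sum _ _ _ fun i hi => ?_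
      have hi1 := mem_withLabel.1 hi
      rw [h.same_eq_of_alive hj1 (by rw [hi1, hj2, one_mul]), hi1, hj2]
      linarith [hlamp i hi]
    have h3 : -Lm ≤ ∑ i ∈ withLabel y (-1), y i * v j * a i j := by
      rw [hLm, ← Finset.sum_neg_distrib]
      refine Finset.sum_le_sum fun i hi => ?_
      rw [mem_withLabel.1 hi, hj2]
      linarith [h.le_lam i j]
    nlinarith
  have hIp : (withLabel y 1).Nonempty := by
    rw [← Finset.card_pos]
    have : 0 < mp := by linarith
    exact (Nat.cast_pos (α := ℝ)).1 this
  obtain ⟨i₀, hi₀⟩ := hIp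
  have hnp1 : np.Nonempty := by
    have h1 := h.alive_nonempty hη (by rw [← hn, ← hm, ← hEdef]; linarith) i₀
    rwa [mem_withLabel.1 hi₀] at h1
  obtain ⟨j₀, hj₀⟩ := hnp1
  have hBp : 2 / 5 * (m * q) ≤ ∑ j ∈ np, b j :=
    (hbp j₀ hj₀).trans (Finset.single_le_sum (f := b)
      (fun j hj => hη.trans (mem_alive.1 hj).1.le) hj₀)
  -- the negative side has small biases
  have hbm : ∀ j ∈ nm, (b j - η) * mp ≤ Lm := fun j hj => by
    obtain ⟨hj1, hj2⟩ := mem_alive.1 hj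
    have h1 := h.bias j
    rw [h.sum_eq_withLabel] at h1
    have h3 : ∑ i ∈ withLabel y (-1), y i * v j * a i j ≤ Lm := by
      refine Finset.sum_le_sum fun i hi => ?_
      rw [mem_withLabel.1 hi, hj2]
      linarith [h.le_lam i j]
    -- Each positive example lowers this bias by its coefficient, which is either the full
    -- multiplier, at least `q / 2`, or at least `b j - η`.
    have h2 : mp * min (q / 2) (b j - η) ≤ -∑ i ∈ withLabel y 1, y i * v j * a i j := by
      rw [hmp, ← nsmul_eq_mul, ← Finset.sum_neg_distrib]
      refine Finset.card_nsmul_le_sum _ _ _ fun i hi => ?_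
      have hi1 := mem_withLabel.1 hi
      rw [hi1, hj2]
      rcases h.opposite_ge (i := i) (j := j) (by rw [hi1, hj2, one_mul]) with h4 | h4
      · rw [h4]
        linarith [hlamp i hi, min_le_left (q / 2) (b j - η)]
      · linarith [min_le_right (q / 2) (b j - η)]
    -- The first case is impossible: a decrease of at least `19/40 * (m * q)` exceeds `Lm ≤ 3/40 *
    -- (m * q)`, yet the bias is positive.
    rcases le_total (q / 2) (b j - η) with h4 | h4
    · rw [min_eq_left h4] at h2
      nlinarith
    · rw [min_eq_right h4] at h2
      nlinarith
  have hBm : (∑ j ∈ nm, b j - nm.card * η) * mp ≤ 3 / 2 * k := by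
    have := Finset.sum_le_card_nsmul _ _ _ hbm
    rw [nsmul_eq_mul, ← Finset.sum_mul, Finset.sum_sub_distrib, Finset.sum_const,
      nsmul_eq_mul] at this
    exact this.trans hLm2
  have hcn : (nm.card : ℝ) ≤ n := by rw [hn]; exact_mod_cast Finset.card_le_univ _
  have hnη : nm.card * η ≤ E := by
    have h1 : nm.card * η ≤ n * η := by gcongr
    have h2 : 0 ≤ n * η := by positivity
    have h3 : n * η ≤ n * η * m := le_mul_of_one_le_right h2 hm1
    have h4 : E = 5 * (n * η * m) := by rw [hEdef]; ring
    linarith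
  have hBeq := h.biasOutput_eq
  rw [← hDdef] at hBeq
  have hqm : q ≤ m * q := le_mul_of_one_le_left hq0.le hm1
  -- Since `D ≤ E`, the negative biases nearly match the positive ones. The resulting lower bound
  -- `19/200 * (m * q)` contradicts the upper bound `3/40 * (m * q)`.
  have h5 : q / 10 ≤ ∑ j ∈ nm, b j - nm.card * η := by linarith
  have h6 : q / 10 * mp ≤ 3 / 2 * k := (mul_le_mul_of_nonneg_right h5 (by linarith)).trans hBm
  have h7 : q / 10 * (19 / 20 * m) ≤ q / 10 * mp :=
    mul_le_mul_of_nonneg_left hmp19 (by linarith)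
  linarith

/-- At an input that is almost orthogonal to the data, the network is positive. -/
theorem sum_relu_pos [Nonempty I] [Nonempty J] (h : ApproxKKT y v lam a z b η) (hη : 0 ≤ η)
    (hE : 5 * Fintype.card J * Fintype.card I * η ≤ 1 / (10 * Fintype.card J))
    (hk : ((withLabel y (-1)).card : ℝ) ≤ Fintype.card I / (20 * Fintype.card J))
    {ζ : J → ℝ} (hζ : ∀ j, |ζ j - b j| ≤ η) : 0 < ∑ j, v j * relu (ζ j) := by
  have h1 := h.biasOutput_gt hη hE hk
  have hm : (1 : ℝ) ≤ Fintype.card I := by exact_mod_cast Fintype.card_pos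
  have hn : (1 : ℝ) ≤ Fintype.card J := by exact_mod_cast Fintype.card_pos
  have h2 : ∑ j, ((if η < b j then v j * b j else 0) - 2 * η) ≤ ∑ j, v j * relu (ζ j) := by
    refine Finset.sum_le_sum fun j _ => ?_
    have h3 := abs_le.1 (hζ j)
    have hr := relu_nonneg (ζ j)
    have hr' := le_relu (ζ j)
    split_ifs with hj
    · have := relu_le (z := ζ j) (c := b j + η) (by linarith) (by linarith)
      rcases h.weight j with hv | hv <;> rw [hv] <;> linarith
    · have := relu_le (z := ζ j) (c := 2 * η) (by linarith) (by linarith)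
      rcases h.weight j with hv | hv <;> rw [hv] <;> linarith
  rw [Finset.sum_sub_distrib, ← biasOutput] at h2
  simp at h2
  have h3 : 0 ≤ (Fintype.card J : ℝ) * η := by positivity
  have h4 : (Fintype.card J : ℝ) * η ≤ Fintype.card J * η * Fintype.card I :=
    le_mul_of_one_le_right h3 hm
  linarith

end ApproxKKT

end BenignKKT

/-! ### From KKT points to approximate KKT systems -/

namespace BenignKKT

open WithLp

variable {n d m : ℕ} {v : Fin n → ℝ} {S : Fin m → Vec d × ℝ} {θ : Params n d}

theorem network_eq (v : Fin n → ℝ) (θ : Params n d) (x : Vec d) :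
    network v θ x = ∑ j, v j * relu (preact θ x j) := rfl

/-- The KKT conditions in coordinates: `a i j` is the multiplier of the `i`-th example times the
subderivative of the ReLU of the `j`-th neuron. -/
structure IsKKTRepr (v : Fin n → ℝ) (S : Fin m → Vec d × ℝ) (θ : Params n d)
    (lam : Fin m → ℝ) (a : Fin m → Fin n → ℝ) : Prop where
  lam_nonneg : ∀ i, 0 ≤ lam i
  nonneg : ∀ i j, 0 ≤ a i j
  le_lam : ∀ i j, a i j ≤ lam i
  active : ∀ i j, 0 < preact θ (S i).1 j → a i j = lam i
  inactive : ∀ i j, preact θ (S i).1 j < 0 → a i j = 0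
  fst_eq : ∀ j, (θ j).fst = ∑ i, ((S i).2 * v j * a i j) • (S i).1
  snd_eq : ∀ j, (θ j).snd = ∑ i, (S i).2 * v j * a i j
  margin : ∀ i, 1 ≤ (S i).2 * network v θ (S i).1
  slack : ∀ i, lam i * ((S i).2 * network v θ (S i).1 - 1) = 0

theorem IsKKTPoint.exists_repr (hv : ∀ j, v j ≠ 0) (h : IsKKTPoint v S θ) :
    ∃ lam a, IsKKTRepr v S θ lam a := by
  obtain ⟨lam, g, hg, hθ, hmar, hlam, hsl⟩ := h
  choose s hs using fun i => clarkeSubdifferential_network_subset hv θ (S i).1 (hg i)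
  have hθj : ∀ j, θ j = ∑ i, ((S i).2 * v j * (lam i * s i j)) • toLp 2 ((S i).1, (1 : ℝ)) := by
    intro j
    conv_lhs => rw [hθ]
    rw [WithLp.ofLp_sum, Finset.sum_apply]
    refine Finset.sum_congr rfl fun i _ => ?_
    rw [PiLp.smul_apply, (hs i j).2.2.2.2, smul_smul]
    congr 1
    ring
  refine ⟨lam, fun i j => lam i * s i j, hlam, fun i j => mul_nonneg (hlam i) (hs i j).1,
    fun i j => mul_le_of_le_one_right (hlam i) (hs i j).2.1, fun i j hz => ?_, fun i j hz => ?_,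
    fun j => ?_, fun j => ?_, hmar, hsl⟩
  · simp [(hs i j).2.2.1 hz]
  · simp [(hs i j).2.2.2.1 hz]
  · have := congrArg (fun q => (WithLp.prodContinuousLinearEquiv 2 ℝ (Vec d) ℝ q).1) (hθj j)
    simpa [map_sum, Prod.fst_sum] using this
  · have := congrArg (fun q => (WithLp.prodContinuousLinearEquiv 2 ℝ (Vec d) ℝ q).2) (hθj j)
    simpa [map_sum, Prod.snd_sum] using this

namespace IsKKTRepr

variable {lam : Fin m → ℝ} {a : Fin m → Fin n → ℝ}

theorem preact_eq (h : IsKKTRepr v S θ lam a) (x : Vec d) (j : Fin n) :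
    preact θ x j = ∑ i, (S i).2 * v j * a i j * inner ℝ (S i).1 x + (θ j).snd := by
  rw [preact, h.fst_eq, sum_inner]
  simp only [inner_smul_left, RCLike.conj_to_real]

theorem abs_coeff (h : IsKKTRepr v S θ lam a) (hy : ∀ i, (S i).2 = 1 ∨ (S i).2 = -1)
    (hv : ∀ j, v j = 1 ∨ v j = -1) (i : Fin m) (j : Fin n) : |(S i).2 * v j * a i j| = a i j := by
  rw [abs_mul, abs_mul, abs_of_nonneg (h.nonneg i j)]
  rcases hy i with h1 | h1 <;> rcases hv j with h2 | h2 <;> simp [h1, h2]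

theorem abs_preact_sub_bias_le (h : IsKKTRepr v S θ lam a)
    (hy : ∀ i, (S i).2 = 1 ∨ (S i).2 = -1) (hv : ∀ j, v j = 1 ∨ v j = -1) {t : ℝ} (ht : 0 ≤ t)
    {x : Vec d} (hx : ∀ i, |inner ℝ (S i).1 x| ≤ t) (j : Fin n) :
    |preact θ x j - (θ j).snd| ≤ t * ∑ i, lam i := by
  rw [h.preact_eq, add_sub_cancel_right, Finset.mul_sum]
  refine (Finset.abs_sum_le_sum_abs _ _).trans (Finset.sum_le_sum fun i _ => ?_)
  rw [abs_mul, h.abs_coeff hy hv, mul_comm]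
  exact mul_le_mul (hx i) (h.le_lam i j) (h.nonneg i j) ht

theorem error (h : IsKKTRepr v S θ lam a)
    (hy : ∀ i, (S i).2 = 1 ∨ (S i).2 = -1) (hv : ∀ j, v j = 1 ∨ v j = -1) {t : ℝ} (ht : 0 ≤ t)
    (hS : ∀ i, ‖(S i).1‖ = 1) (hx : ∀ i l, i ≠ l → |inner ℝ (S i).1 (S l).1| ≤ t)
    (i : Fin m) (j : Fin n) :
    |preact θ (S i).1 j - ((S i).2 * v j * a i j + (θ j).snd)| ≤ t * ∑ i, lam i := by
  rw [h.preact_eq, ← Finset.add_sum_erase _ _ (Finset.mem_univ i), real_inner_self_eq_norm_sq,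
    hS i, one_pow, mul_one, add_right_comm, add_sub_cancel_left]
  refine (Finset.abs_sum_le_sum_abs _ _).trans ?_
  rw [Finset.mul_sum, ← Finset.add_sum_erase Finset.univ _ (Finset.mem_univ i)]
  refine le_add_of_nonneg_of_le (mul_nonneg ht (h.lam_nonneg i))
    (Finset.sum_le_sum fun l hl => ?_)
  rw [abs_mul, h.abs_coeff hy hv, mul_comm]
  exact mul_le_mul (hx l i (Finset.ne_of_mem_erase hl)) (h.le_lam l j) (h.nonneg l j) ht

theorem approxKKT (h : IsKKTRepr v S θ lam a)
    (hy : ∀ i, (S i).2 = 1 ∨ (S i).2 = -1) (hv : ∀ j, v j = 1 ∨ v j = -1) {η : ℝ}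
    (he : ∀ i j, |preact θ (S i).1 j - ((S i).2 * v j * a i j + (θ j).snd)| ≤ η) :
    ApproxKKT (fun i => (S i).2) v lam a (fun i j => preact θ (S i).1 j) (fun j => (θ j).snd) η where
  label := hy
  weight := hv
  nonneg := h.nonneg
  le_lam := h.le_lam
  active := h.active
  inactive := h.inactive
  bias := h.snd_eq
  error := he
  margin := h.margin
  slack := h.slack

/-- Euler's identity: the network is 1-homogeneous in `θ`, so pairing stationarity with `θ` gives
`‖θ‖² = ∑ λ_i y_i N(x_i)`, and slackness replaces each `y_i N(x_i)` by `1`. -/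
theorem sum_lam_eq (h : IsKKTRepr v S θ lam a) :
    ∑ i, lam i = ∑ j, (‖(θ j).fst‖ ^ 2 + (θ j).snd ^ 2) := by
  have h1 : ∀ i, lam i = ∑ j, (S i).2 * v j * a i j * preact θ (S i).1 j := fun i => by
    have h2 : lam i = lam i * ((S i).2 * network v θ (S i).1) := by linarith [h.slack i]
    rw [h2, network_eq, Finset.mul_sum, Finset.mul_sum]
    refine Finset.sum_congr rfl fun j _ => ?_
    have h3 : lam i * relu (preact θ (S i).1 j) = a i j * preact θ (S i).1 j := by
      rcases lt_trichotomy (preact θ (S i).1 j) 0 with hz | hz | hz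
      · rw [h.inactive i j hz, relu, max_eq_left hz.le]
        simp
      · rw [hz]
        simp [relu]
      · rw [h.active i j hz, relu, max_eq_right hz.le]
    linear_combination (S i).2 * v j * h3
  rw [Finset.sum_congr rfl fun i _ => h1 i, Finset.sum_comm]
  refine Finset.sum_congr rfl fun j _ => ?_
  simp only [preact, mul_add, Finset.sum_add_distrib]
  congr 1
  · conv_rhs => rw [← real_inner_self_eq_norm_sq]
    nth_rw 3 [h.fst_eq j]
    rw [inner_sum]
    simp only [inner_smul_right]
  · rw [← Finset.sum_mul, ← h.snd_eq, sq]

theorem exists_active (h : IsKKTRepr v S θ lam a) (i : Fin m) : ∃ j, a i j = lam i := by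
  by_contra! hc
  have h1 := h.margin i
  rw [network_eq, Finset.sum_eq_zero] at h1
  · linarith
  · intro j _
    rw [relu, max_eq_left, mul_zero]
    by_contra! hz
    exact hc j (h.active i j hz)

theorem norm_fst_sq_ge (h : IsKKTRepr v S θ lam a) (hy : ∀ i, (S i).2 = 1 ∨ (S i).2 = -1)
    (hv : ∀ j, v j = 1 ∨ v j = -1) {t : ℝ} (ht : 0 ≤ t)
    (hS : ∀ i, ‖(S i).1‖ = 1) (hx : ∀ i l, i ≠ l → |inner ℝ (S i).1 (S l).1| ≤ t) (j : Fin n) :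
    ∑ i, a i j ^ 2 - t * (∑ i, lam i) ^ 2 ≤ ‖(θ j).fst‖ ^ 2 := by
  have hc := h.abs_coeff hy hv
  have h1 : ‖(θ j).fst‖ ^ 2 = ∑ i, ∑ l, (S i).2 * v j * a i j * ((S l).2 * v j * a l j) *
      inner ℝ (S i).1 (S l).1 := by
    rw [← real_inner_self_eq_norm_sq, h.fst_eq, sum_inner]
    refine Finset.sum_congr rfl fun i _ => ?_
    rw [inner_sum]
    refine Finset.sum_congr rfl fun l _ => ?_
    rw [inner_smul_left, inner_smul_right, RCLike.conj_to_real]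
    ring
  have h2 : ∀ i, a i j ^ 2 - t * (lam i * ∑ l, lam l) ≤
      ∑ l, (S i).2 * v j * a i j * ((S l).2 * v j * a l j) * inner ℝ (S i).1 (S l).1 := fun i => by
    have h3 : ∀ l, (if l = i then a i j ^ 2 else 0) - t * (lam i * lam l) ≤
        (S i).2 * v j * a i j * ((S l).2 * v j * a l j) * inner ℝ (S i).1 (S l).1 := fun l => by
      have hpos : 0 ≤ t * (lam i * lam l) :=
        mul_nonneg ht (mul_nonneg (h.lam_nonneg i) (h.lam_nonneg l))
      split_ifs with hl
      · subst hl
        have h4 := sq_abs ((S l).2 * v j * a l j)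
        rw [hc] at h4
        rw [real_inner_self_eq_norm_sq, hS]
        linarith
      · have h4 : |(S i).2 * v j * a i j * ((S l).2 * v j * a l j) * inner ℝ (S i).1 (S l).1| ≤
            t * (lam i * lam l) := by
          rw [abs_mul, abs_mul, hc, hc, mul_comm]
          exact mul_le_mul (hx i l (Ne.symm hl)) (mul_le_mul (h.le_lam i j) (h.le_lam l j)
            (h.nonneg l j) (h.lam_nonneg i)) (mul_nonneg (h.nonneg i j) (h.nonneg l j)) ht
        linarith [(abs_le.1 h4).1]
    have h5 := Finset.sum_le_sum fun l (_ : l ∈ Finset.univ) => h3 l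
    rw [Finset.sum_sub_distrib, ← Finset.mul_sum, ← Finset.mul_sum] at h5
    simpa using h5
  rw [h1]
  refine le_trans (le_of_eq ?_) (Finset.sum_le_sum fun i _ => h2 i)
  rw [Finset.sum_sub_distrib, ← Finset.mul_sum, ← Finset.sum_mul, sq]

/-- The margin forces an active neuron at each example, hence `∑ λ_i² ≤ ∑ a_ij² ≤ L + n t L²`. By
Cauchy–Schwarz, `L² ≤ m L + m n t L² ≤ m L + L²/2`. -/
theorem sum_lam_le (h : IsKKTRepr v S θ lam a) (hy : ∀ i, (S i).2 = 1 ∨ (S i).2 = -1)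
    (hv : ∀ j, v j = 1 ∨ v j = -1) {t : ℝ} (ht : 0 ≤ t)
    (hS : ∀ i, ‖(S i).1‖ = 1) (hx : ∀ i l, i ≠ l → |inner ℝ (S i).1 (S l).1| ≤ t)
    (htm : 2 * m * n * t ≤ 1) : ∑ i, lam i ≤ 2 * m := by
  set L := ∑ i, lam i with hL
  have hL0 : 0 ≤ L := Finset.sum_nonneg fun i _ => h.lam_nonneg i
  have h1 : ∑ j, (∑ i, a i j ^ 2 - t * L ^ 2) ≤ L := by
    rw [h.sum_lam_eq] at hL
    conv_rhs => rw [hL]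
    exact Finset.sum_le_sum fun j _ =>
      (h.norm_fst_sq_ge hy hv ht hS hx j).trans (le_add_of_nonneg_right (sq_nonneg _))
  rw [Finset.sum_sub_distrib, Finset.sum_comm] at h1
  have h2 : ∑ i, lam i ^ 2 ≤ ∑ i, ∑ j, a i j ^ 2 := Finset.sum_le_sum fun i _ => by
    obtain ⟨j, hj⟩ := h.exists_active i
    rw [← hj]
    exact Finset.single_le_sum (f := fun j => a i j ^ 2) (fun j _ => sq_nonneg _)
      (Finset.mem_univ j)
  have h3 : L ^ 2 ≤ m * ∑ i, lam i ^ 2 := by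
    have := sq_sum_le_card_mul_sum_sq (s := Finset.univ) (f := lam)
    simpa using this
  simp at h1
  have hm0 : (0 : ℝ) ≤ m := Nat.cast_nonneg m
  have h4 : m * (∑ i, lam i ^ 2) ≤ m * (L + n * (t * L ^ 2)) := by gcongr; linarith
  by_contra! hc
  have h5 : m * n * t * L ^ 2 ≤ 1 / 2 * L ^ 2 := by
    gcongr
    linarith
  nlinarith

theorem network_pos (h : IsKKTRepr v S θ lam a) (hm : 0 < m) (hn : 0 < n)
    (hy : ∀ i, (S i).2 = 1 ∨ (S i).2 = -1) (hv : ∀ j, v j = 1 ∨ v j = -1) {t : ℝ} (ht : 0 ≤ t)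
    (htm : 100 * m ^ 2 * n ^ 2 * t ≤ 1)
    (hS : ∀ i, ‖(S i).1‖ = 1) (hx : ∀ i l, i ≠ l → |inner ℝ (S i).1 (S l).1| ≤ t)
    (hk : ((ApproxKKT.withLabel (fun i => (S i).2) (-1)).card : ℝ) ≤ m / (20 * n))
    {x : Vec d} (hxt : ∀ i, |inner ℝ (S i).1 x| ≤ t) : 0 < network v θ x := by
  have hI : Nonempty (Fin m) := ⟨⟨0, hm⟩⟩
  have hJ : Nonempty (Fin n) := ⟨⟨0, hn⟩⟩
  have hm1 : (1 : ℝ) ≤ m := by exact_mod_cast hm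
  have hn1 : (1 : ℝ) ≤ n := by exact_mod_cast hn
  have hmn : (m : ℝ) * n ≤ m ^ 2 * n ^ 2 := by
    have : 1 ≤ (m : ℝ) * n := one_le_mul_of_one_le_of_one_le hm1 hn1
    nlinarith
  have hL := h.sum_lam_le hy hv ht hS hx (by nlinarith)
  have hη : 0 ≤ t * ∑ i, lam i := mul_nonneg ht (Finset.sum_nonneg fun i _ => h.lam_nonneg i)
  rw [network_eq]
  refine (h.approxKKT hy hv (h.error hy hv ht hS hx)).sum_relu_pos hη ?_ ?_
    (h.abs_preact_sub_bias_le hy hv ht hxt)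
  · rw [Fintype.card_fin, Fintype.card_fin, le_div_iff₀ (by positivity)]
    have h1 : t * ∑ i, lam i ≤ t * (2 * m) := by gcongr
    calc 5 * (n : ℝ) * m * (t * ∑ i, lam i) * (10 * n)
        ≤ 5 * (n : ℝ) * m * (t * (2 * m)) * (10 * n) := by gcongr
      _ = 100 * m ^ 2 * n ^ 2 * t := by ring
      _ ≤ 1 := htm
  · simpa using hk

/-- A neuron with `v j = -1` would have preactivation `-2 a` at the example, which kills its
coefficient. The others share the factor `⟨x₁, x⟩ + 1`, positive on the sphere away from the
antipode. -/
theorem network_pos_of_single {S : Fin 1 → Vec d × ℝ} {lam : Fin 1 → ℝ} {a : Fin 1 → Fin n → ℝ}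
    (h : IsKKTRepr v S θ lam a) (hv : ∀ j, v j = 1 ∨ v j = -1) (hy : (S 0).2 = 1)
    (hS : ‖(S 0).1‖ = 1) {x : Vec d} (hx : ‖x‖ = 1) (hne : x ≠ -(S 0).1) :
    0 < network v θ x := by
  have hpre : ∀ x j, preact θ x j = v j * a 0 j * (inner ℝ (S 0).1 x + 1) := fun x j => by
    rw [h.preact_eq, h.snd_eq]
    simp [hy]
    ring
  have hself : ∀ j, preact θ (S 0).1 j = 2 * (v j * a 0 j) := fun j => by
    rw [hpre, real_inner_self_eq_norm_sq, hS]
    ring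
  have hneg : ∀ j, v j = -1 → a 0 j = 0 := fun j hj => by
    by_contra h0
    have h1 : 0 < a 0 j := lt_of_le_of_ne (h.nonneg 0 j) (Ne.symm h0)
    exact h0 (h.inactive 0 j (by rw [hself, hj]; linarith))
  have hin : 0 < inner ℝ (S 0).1 x + 1 := by
    by_contra! hc
    apply hne
    have h1 : ‖x + (S 0).1‖ ^ 2 ≤ 0 := by
      rw [norm_add_sq_real, hx, hS, real_inner_comm]
      linarith
    have h2 : ‖x + (S 0).1‖ = 0 := by nlinarith [norm_nonneg (x + (S 0).1)]
    exact eq_neg_of_add_eq_zero_left (norm_eq_zero.1 h2)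
  have hterm : ∀ c : ℝ, 0 ≤ c → ∀ j, v j * relu (v j * a 0 j * c) = a 0 j * c := fun c hc j => by
    rcases hv j with hj | hj
    · rw [hj, one_mul, one_mul, relu, max_eq_right (mul_nonneg (h.nonneg 0 j) hc)]
    · rw [hneg j hj]
      simp [relu]
  have hnet : ∀ x, 0 ≤ inner ℝ (S 0).1 x + 1 →
      network v θ x = (∑ j, a 0 j) * (inner ℝ (S 0).1 x + 1) := fun x hx0 => by
    rw [network_eq, Finset.sum_mul]
    exact Finset.sum_congr rfl fun j _ => by rw [hpre, hterm _ hx0]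
  have h1 := h.margin 0
  rw [hnet _ (by rw [real_inner_self_eq_norm_sq]; positivity), hy, real_inner_self_eq_norm_sq,
    hS] at h1
  rw [hnet x hin.le]
  exact mul_pos (by linarith) hin

end IsKKTRepr

end BenignKKT

/-! ### Test error and choice of constants -/

namespace BenignKKT

theorem negCount_eq_card {m d : ℕ} (S : Fin m → Vec d × ℝ) :
    negCount S = ((ApproxKKT.withLabel (fun i => (S i).2) (-1)).card : ℝ) := by
  rw [negCount, Finset.sum_boole, ApproxKKT.withLabel]

theorem exp_neg_le_inv_sq {q X : ℝ} (hq : 0 < q) (h : 2 * Real.log q ≤ X) :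
    Real.exp (-X) ≤ (q ^ 2)⁻¹ := by
  rw [Real.exp_neg]
  apply inv_anti₀ (by positivity)
  rw [← Real.log_le_iff_le_exp (by positivity), Real.log_pow]
  exact_mod_cast h

theorem cleanError_le {n d m : ℕ} {v : Fin n → ℝ} {θ : Params n d} {S : Fin m → Vec d × ℝ}
    (hd : 0 < d) (hS : ∀ i, ‖(S i).1‖ = 1) {t : ℝ} (ht : 0 ≤ t) (ht2 : t ^ 2 ≤ 1 / 2)
    (h : ∀ x, (∀ i, |inner ℝ (S i).1 x| ≤ t) → 0 < network v θ x) :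
    cleanError v θ ≤ m * (2 * Real.exp (-(d * t ^ 2 / 2))) := by
  have hsub : {x | network v θ x ≤ 0} ⊆ ⋃ i, {x | t < |inner ℝ (S i).1 x|} := by
    intro x (hx : network v θ x ≤ 0)
    by_contra hc
    simp only [Set.mem_iUnion, Set.mem_ofPred_eq, not_exists, not_lt] at hc
    exact absurd (h x hc) (not_lt.2 hx)
  refine ENNReal.toReal_le_of_le_ofReal (by positivity) ?_
  refine (measure_mono hsub).trans ((measure_iUnion_fintype_le _ _).trans ?_)
  refine (Finset.sum_le_card_nsmul _ _ _ fun i _ =>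
    unifSphere_abs_inner_le hd (hS i) ht ht2).trans_eq ?_
  rw [ENNReal.ofReal_mul (p := (m : ℝ)) (by positivity), nsmul_eq_mul, ENNReal.ofReal_natCast,
    Finset.card_univ, Fintype.card_fin]

theorem cleanError_eq_zero_of_single {n d : ℕ} {v : Fin n → ℝ} {θ : Params n d}
    {S : Fin 1 → Vec d × ℝ} (hd : 2 ≤ d) (hv : ∀ j, v j = 1 ∨ v j = -1) (hy : (S 0).2 = 1)
    (hS : ‖(S 0).1‖ = 1) (h : IsKKTPoint v S θ) : cleanError v θ = 0 := by
  obtain ⟨lam, a, hr⟩ := h.exists_repr fun j => by rcases hv j with h | h <;> rw [h] <;> norm_num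
  have hne : ∀ᵐ x ∂(unifSphere d), x ≠ -(S 0).1 := by
    rw [ae_iff]
    simpa using unifSphere_singleton hd (-(S 0).1)
  have hae : ∀ᵐ x ∂(unifSphere d), ¬ network v θ x ≤ 0 := by
    filter_upwards [ae_norm_eq_one_unifSphere d, hne] with x hx1 hx2
    exact not_le.2 (hr.network_pos_of_single hv hy hS hx1 hx2)
  rw [ae_iff] at hae
  simp only [not_not] at hae
  rw [cleanError, measureReal_def, hae, ENNReal.toReal_zero]

end BenignKKT

theorem theorem5 :
    ∃ c₁ c₂ c₃ : ℝ, 0 < c₁ ∧ 0 < c₂ ∧ 0 < c₃ ∧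
      ∀ (n m d : ℕ) (p ε δ : ℝ) (v : Fin n → ℝ),
        0 < n → 2 ≤ d → 0 ≤ p → p ≤ 1 → 0 < ε → 0 < δ →
        p ≤ c₁ / (n : ℝ) ^ 2 →
        c₂ * n * Real.log (1 / δ) ≤ m →
        c₃ * (m : ℝ) ^ 4 * (n : ℝ) ^ 4 * Real.log (m / ε) * Real.log ((m : ℝ) ^ 2 / δ) ≤ d →
        (∀ j, v j = 1 ∨ v j = -1) →
        {j | v j = 1}.ncard = {j | v j = -1}.ncard →
        ∃ G : Set (Fin m → BenignKKT.Vec d × ℝ), MeasurableSet G ∧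
          ENNReal.ofReal (1 - δ) ≤ BenignKKT.sampleDist m d p G ∧
          ∀ S ∈ G, ∀ θ : BenignKKT.Params n d,
            BenignKKT.IsKKTPoint v S θ → BenignKKT.cleanError v θ ≤ ε := by
  refine ⟨1 / 400, 20, 100000, by norm_num, by norm_num, by norm_num, ?_⟩
  intro n m d p ε δ v hn hd hp0 hp1 hε hδ hp hm hdl hv _
  have hd0 : 0 < d := by omega
  have := BenignKKT.isProbabilityMeasure_unifSphere hd0
  have := BenignKKT.isProbabilityMeasure_labelDist hp0 hp1
  rcases le_or_gt 1 δ with hδ1 | hδ1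
  · refine ⟨∅, MeasurableSet.empty, ?_, by simp⟩
    rw [ENNReal.ofReal_of_nonpos (by linarith)]
    exact zero_le
  have hn1 : (1 : ℝ) ≤ n := by exact_mod_cast hn
  have hlogδ : 0 < Real.log (1 / δ) := Real.log_pos (by rw [lt_div_iff₀ hδ]; linarith)
  have hm0 : 0 < m := by
    have : (0 : ℝ) < m := lt_of_lt_of_le (by positivity) hm
    exact_mod_cast this
  have hm1 : (1 : ℝ) ≤ m := by exact_mod_cast hm0
  rcases le_or_gt 1 ε with hε1 | hε1
  · refine ⟨Set.univ, MeasurableSet.univ, ?_, fun S _ θ _ => measureReal_le_one.trans hε1⟩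
    rw [measure_univ]
    exact ENNReal.ofReal_le_one.2 (by linarith)
  set K : ℝ := m / (20 * n) with hK
  -- This makes `η ≤ 2mt` small enough for `network_pos`, with equality in its condition on `t`.
  set t : ℝ := 1 / (100 * m ^ 2 * n ^ 2) with ht
  have ht0 : 0 ≤ t := by positivity
  have htm : 100 * (m : ℝ) ^ 2 * n ^ 2 * t = 1 := by rw [ht]; field_simp
  have ht2 : t ^ 2 ≤ 1 / 2 := by
    have h1 : (1 : ℝ) ≤ m ^ 2 * n ^ 2 :=
      one_le_mul_of_one_le_of_one_le (one_le_pow₀ hm1) (one_le_pow₀ hn1)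
    have h2 : t ≤ 1 / 100 := by
      rw [ht]
      apply one_div_le_one_div_of_le (by norm_num)
      linarith
    nlinarith
  have hpK : 20 * (m * p) ≤ K := by
    have h1 : p ≤ 1 / (400 * n) := by
      refine hp.trans ?_
      rw [div_div]
      apply one_div_le_one_div_of_le (by positivity)
      nlinarith
    calc 20 * (m * p) ≤ 20 * (m * (1 / (400 * n))) := by gcongr
      _ = K := by rw [hK]; field_simp; norm_num
  have hKδ : Real.log (1 / δ) ≤ K := by
    rw [hK, le_div_iff₀ (by positivity)]
    linarith
  -- For `m = 1` both logarithms may be arbitrarily small, so the bound on `d` gives no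
  -- concentration and the exact one-sample analysis is used. For `m ≥ 2` each is at least `log 2`,
  -- so their product controls either one.
  have hexp : m = 1 ∨ 2 * Real.log ((m : ℝ) ^ 2 / δ) ≤ d * t ^ 2 / 2 ∧
      2 * Real.log (m / ε) ≤ d * t ^ 2 / 2 ∧ (2 : ℝ) ≤ m := by
    rcases Nat.lt_or_ge m 2 with h | h
    · exact Or.inl (by omega)
    right
    have hm2 : (2 : ℝ) ≤ m := by exact_mod_cast h
    have hl2 := Real.log_two_gt_d9
    have h1 : Real.log 2 ≤ Real.log (m / ε) :=
      Real.log_le_log (by norm_num) (by rw [le_div_iff₀ hε]; nlinarith)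
    have h2 : Real.log 2 ≤ Real.log ((m : ℝ) ^ 2 / δ) :=
      Real.log_le_log (by norm_num) (by rw [le_div_iff₀ hδ]; nlinarith)
    have h3 : 10 * (Real.log (m / ε) * Real.log ((m : ℝ) ^ 2 / δ)) ≤ d * t ^ 2 := by
      calc 10 * (Real.log (m / ε) * Real.log ((m : ℝ) ^ 2 / δ))
          = (100000 * (m : ℝ) ^ 4 * (n : ℝ) ^ 4 * Real.log (m / ε) *
              Real.log ((m : ℝ) ^ 2 / δ)) * t ^ 2 := by rw [ht]; field_simp; ring
        _ ≤ d * t ^ 2 := by gcongr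
    exact ⟨by nlinarith, by nlinarith, hm2⟩
  refine ⟨BenignKKT.goodSamples m d t K, BenignKKT.measurableSet_goodSamples m d t K,
    BenignKKT.le_sampleDist_goodSamples hd0 hp0 hδ ht0 ht2 ?_ hpK hKδ, ?_⟩
  · refine hexp.imp_right fun ⟨h, _, hm2⟩ => ?_
    calc (m : ℝ) ^ 2 * (2 * Real.exp (-(d * t ^ 2 / 2)))
        ≤ (m : ℝ) ^ 2 * (2 * (((m : ℝ) ^ 2 / δ) ^ 2)⁻¹) := by
          gcongr
          exact BenignKKT.exp_neg_le_inv_sq (by positivity) h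
      _ = 2 * δ * (δ / m ^ 2) := by field_simp
      _ ≤ 2 * δ * (1 / 4) := by
          refine mul_le_mul_of_nonneg_left ?_ (by positivity)
          rw [div_le_div_iff₀ (by positivity) (by norm_num)]
          nlinarith
      _ = δ / 2 := by ring
  · rintro S ⟨hS, hneg, hinn⟩ θ hθ
    have hv0 : ∀ j, v j ≠ 0 := fun j => by rcases hv j with h | h <;> rw [h] <;> norm_num
    rcases hexp with rfl | ⟨-, h, hm2⟩
    -- Here `K = 1/(20n) < 1`, so a good sample has no negative label.
    · have hy : (S 0).2 = 1 := by
        refine (hS 0).2.resolve_right fun hy => ?_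
        have h1 : BenignKKT.negCount S = 1 := by
          rw [BenignKKT.negCount, Fin.sum_univ_one, if_pos hy]
        rw [h1, hK, le_div_iff₀ (by positivity)] at hneg
        push_cast at hneg
        linarith
      exact (BenignKKT.cleanError_eq_zero_of_single hd hv hy (hS 0).1 hθ).trans_le hε.le
    · obtain ⟨lam, a, hr⟩ := hθ.exists_repr hv0
      refine (BenignKKT.cleanError_le hd0 (fun i => (hS i).1) ht0 ht2 fun x hx =>
        hr.network_pos hm0 hn (fun i => (hS i).2) hv ht0 htm.le (fun i => (hS i).1) hinn
          ((BenignKKT.negCount_eq_card S).symm.trans_le hneg) hx).trans ?_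
      calc (m : ℝ) * (2 * Real.exp (-(d * t ^ 2 / 2)))
          ≤ m * (2 * ((m / ε) ^ 2)⁻¹) := by
            gcongr
            exact BenignKKT.exp_neg_le_inv_sq (by positivity) h
        _ = 2 / m * ε * ε := by field_simp
        _ ≤ 1 * ε * 1 := by
            gcongr
            rw [div_le_one (by positivity)]
            exact hm2
        _ = ε := by ring
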